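/- Let $S=(-\frac{\pi}{2},\frac{\pi}{2})^2$ and, for $h\ge 0$, consider the Robin eigenvalue problem: $u\in H^1(S)$ real valued, $-\Delta u=\lambda u$ in $S$, $\partial_\nu u+h\,u=0$ on $\partial S$ (in the weak sense). Let $\lambda_{1,h}\le\lambda_{2,h}\le\dots$ be its eigenvalues, counted with multiplicity. For $n\in\mathbb N=\{0,1,2,\dots\}$ let $\alpha_n(h)$ be the unique solution in $[n\pi,(n+1)\pi)$ of $\alpha\sin\frac{\alpha}{2}=h\pi\cos\frac{\alpha}{2}$ if $n$ is even, and of $\alpha\cos\frac{\alpha}{2}=-h\pi\sin\frac{\alpha}{2}$ if $n$ is odd, and put $\lambda_{p,q,h}=\pi^{-2}(\alpha_p(h)^2+\alpha_q(h)^2)$; in particular $\lambda_{p,q,0}=p^2+q^2$. The nodal domains of an eigenfunction $u$ are the connected components of $\{z\in S: u(z)\neq 0\}$ (with $u$ taken continuous in $S$); $\lambda_{n,h}$ is called Courant-sharp if it has an eigenfunction with exactly $n$ nodal domains. (i) Let $p\in\mathbb N$ be such that the eigenspace of the problem with $h=0$ for the eigenvalue $\lambda_{p,p,0}$ is one-dimensional.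 Then there is $h_0>0$ (depending on $p$) such that for all $0\le h\le h_0$ the eigenspace for $\lambda_{p,p,h}$ is one-dimensional and every eigenfunction associated with $\lambda_{p,p,h}$ has exactly $(p+1)^2$ nodal domains. (ii) There is $h_0>0$ such that for all $0<h\le h_0$ none of the eigenvalues $\lambda_{20,h}$, $\lambda_{31,h}$, $\lambda_{65,h}$, $\lambda_{86,h}$, $\lambda_{113,h}$ is Courant-sharp. -/

import Mathlib

open MeasureTheory Set

namespace RobinSquare

noncomputable section

/-- The open square `S = (-π/2, π/2)²`. -/
def square : Set (ℝ × ℝ) :=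
  Ioo (-(Real.pi / 2)) (Real.pi / 2) ×ˢ Ioo (-(Real.pi / 2)) (Real.pi / 2)

/-- Lebesgue measure on the side interval `(-π/2, π/2)`. -/
def sideMeasure : Measure ℝ := volume.restrict (Ioo (-(Real.pi / 2)) (Real.pi / 2))

/-- Lebesgue measure on `S`. -/
def area : Measure (ℝ × ℝ) := volume.restrict square

/-- Arc length on `∂S`: the sum of the length measures of the four sides. -/
def arcLength : Measure (ℝ × ℝ) :=
  sideMeasure.map (fun t => (Real.pi / 2, t)) + sideMeasure.map (fun t => (-(Real.pi / 2), t)) +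
    (sideMeasure.map (fun t => (t, Real.pi / 2)) + sideMeasure.map (fun t => (t, -(Real.pi / 2))))

/-- `L²(S)`, real valued. -/
abbrev L2S : Type := Lp ℝ 2 area

/-- `L²(∂S)`, real valued. -/
abbrev L2B : Type := Lp ℝ 2 arcLength

/-- The quadruples `(φ, ∂₁φ, ∂₂φ, φ|_{∂S})` for `φ` smooth up to the boundary of `S`. -/
def smoothGraph : Submodule ℝ (L2S × L2S × L2S × L2B) where
  carrier := {w | ∃ φ : ℝ × ℝ → ℝ, ContDiff ℝ (⊤ : ℕ∞) φ ∧
    w.1 =ᵐ[area] φ ∧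
    w.2.1 =ᵐ[area] (fun z => fderiv ℝ φ z (1, 0)) ∧
    w.2.2.1 =ᵐ[area] (fun z => fderiv ℝ φ z (0, 1)) ∧
    w.2.2.2 =ᵐ[arcLength] φ}
  add_mem' := by
    rintro a b ⟨φ, hφ, h1, h2, h3, h4⟩ ⟨ψ, hψ, k1, k2, k3, k4⟩
    have dφ : Differentiable ℝ φ := hφ.differentiable (by simp)
    have dψ : Differentiable ℝ ψ := hψ.differentiable (by simp)
    refine ⟨φ + ψ, hφ.add hψ, ?_, ?_, ?_, ?_⟩
    · exact (Lp.coeFn_add _ _).trans (h1.add k1)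
    · refine (Lp.coeFn_add _ _).trans ((h2.add k2).trans (Filter.Eventually.of_forall ?_))
      intro z
      simp [fderiv_add (dφ z) (dψ z)]
    · refine (Lp.coeFn_add _ _).trans ((h3.add k3).trans (Filter.Eventually.of_forall ?_))
      intro z
      simp [fderiv_add (dφ z) (dψ z)]
    · exact (Lp.coeFn_add _ _).trans (h4.add k4)
  zero_mem' := by
    refine ⟨0, contDiff_const, Lp.coeFn_zero _ _ _, ?_, ?_, Lp.coeFn_zero _ _ _⟩
    · refine (Lp.coeFn_zero _ _ _).trans (Filter.Eventually.of_forall ?_)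
      intro z
      simp
    · refine (Lp.coeFn_zero _ _ _).trans (Filter.Eventually.of_forall ?_)
      intro z
      simp
  smul_mem' := by
    rintro c a ⟨φ, hφ, h1, h2, h3, h4⟩
    have dφ : Differentiable ℝ φ := hφ.differentiable (by simp)
    refine ⟨c • φ, contDiff_const.smul hφ, ?_, ?_, ?_, ?_⟩
    · exact (Lp.coeFn_smul _ _).trans (h1.const_smul c)
    · refine (Lp.coeFn_smul _ _).trans ((h2.const_smul c).trans (Filter.Eventually.of_forall ?_))
      intro z
      simp [fderiv_const_smul (dφ z) c]
    · refine (Lp.coeFn_smul _ _).trans ((h3.const_smul c).trans (Filter.Eventually.of_forall ?_))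
      intro z
      simp [fderiv_const_smul (dφ z) c]
    · exact (Lp.coeFn_smul _ _).trans (h4.const_smul c)

/-- The Sobolev space `H¹(S)`, with each `u` recorded together with its weak gradient and its
boundary trace as `(u, ∂₁u, ∂₂u, tr u)`: the closure of the smooth quadruples in
`L²(S) × L²(S) × L²(S) × L²(∂S)`. -/
def H1 : Submodule ℝ (L2S × L2S × L2S × L2B) := smoothGraph.topologicalClosure

/-- The bilinear form of the Robin Laplacian, `∫_S ∇u · ∇v + h ∫_{∂S} u v`. -/
def robinForm (h : ℝ) (u v : L2S × L2S × L2S × L2B) : ℝ :=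
  inner ℝ u.2.1 v.2.1 + inner ℝ u.2.2.1 v.2.2.1 + h * inner ℝ u.2.2.2 v.2.2.2

/-- The space of weak solutions `u ∈ H¹(S)` of `-Δu = lam • u` in `S`, `∂u/∂ν + h u = 0` on `∂S`,
as a subspace of `L²(S)`. -/
def eigenspace (h lam : ℝ) : Submodule ℝ L2S where
  carrier := {u | ∃ U ∈ H1, U.1 = u ∧ ∀ V ∈ H1, robinForm h U V = lam * inner ℝ U.1 V.1}
  add_mem' := by
    rintro a b ⟨U, hU, rfl, h1⟩ ⟨W, hW, rfl, h2⟩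
    refine ⟨U + W, H1.add_mem hU hW, rfl, fun V hV => ?_⟩
    have e1 := h1 V hV
    have e2 := h2 V hV
    simp only [robinForm, Prod.fst_add, Prod.snd_add, inner_add_left] at e1 e2 ⊢
    linear_combination e1 + e2
  zero_mem' := ⟨0, H1.zero_mem, rfl, fun V _ => by simp [robinForm]⟩
  smul_mem' := by
    rintro c a ⟨U, hU, rfl, h1⟩
    refine ⟨c • U, H1.smul_mem c hU, rfl, fun V hV => ?_⟩
    have e1 := h1 V hV
    simp only [robinForm, Prod.smul_fst, Prod.smul_snd, real_inner_smul_left] at e1 ⊢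
    linear_combination c * e1

/-- `λ_{n,h}`, for `n ≥ 1`: the `n`-th Robin eigenvalue of `S` in increasing order, counted with
multiplicity, i.e. the least `lam` such that the eigenspaces of the eigenvalues `≤ lam` together
have dimension at least `n`. -/
def nthEigenvalue (h : ℝ) (n : ℕ) : ℝ :=
  sInf {lam : ℝ | (n : Cardinal) ≤
    Module.rank ℝ ↥(⨆ (mu : ℝ) (_ : mu ≤ lam), eigenspace h mu)}

/-- `α_n(h)`, for `h ≥ 0`: the unique `α` in `[nπ, (n+1)π)` such that `cos (α x / π)`, for `n`
even, or `sin (α x / π)`, for `n` odd, satisfies the `h`-Robin condition at `x = ± π/2`. For `n`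
even this is `α tan (α/2) = hπ` and for `n` odd it is `α / (hπ) = -tan (α/2)`; the denominators are
cleared so that the case `h = 0`, where `α_n(0) = nπ`, is included. -/
def robinAlpha (n : ℕ) (h : ℝ) : ℝ :=
  sInf {a : ℝ | a ∈ Ico (n * Real.pi) ((n + 1) * Real.pi) ∧
    if Even n then a * Real.sin (a / 2) = h * Real.pi * Real.cos (a / 2)
    else a * Real.cos (a / 2) = -(h * Real.pi * Real.sin (a / 2))}

/-- `λ_{p,q,h} = π⁻² (α_p(h)² + α_q(h)²)`. -/
def pairEigenvalue (p q : ℕ) (h : ℝ) : ℝ :=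
  (robinAlpha p h ^ 2 + robinAlpha q h ^ 2) / Real.pi ^ 2

/-- `u` has exactly `n` nodal domains: the continuous representative of `u` on `S` has exactly `n`
connected components of its non-vanishing set in `S`. As `S` is open, there is at most one
continuous representative on `S`. -/
def HasNodalDomains (u : L2S) (n : ℕ) : Prop :=
  ∃ f : ℝ × ℝ → ℝ, ContinuousOn f square ∧ u =ᵐ[area] f ∧
    ENat.card (ConnectedComponents {z : ℝ × ℝ // z ∈ square ∧ f z ≠ 0}) = n

/-- `λ_{n,h}` is Courant-sharp: it has an eigenfunction with exactly `n` nodal domains. -/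
def CourantSharp (h : ℝ) (n : ℕ) : Prop :=
  ∃ u ∈ eigenspace h (nthEigenvalue h n), u ≠ 0 ∧ HasNodalDomains u n

end

end RobinSquare

open Filter Topology

namespace RobinSquare

/-! The products of one-dimensional Robin modes are weak eigenfunctions for `pairEigenvalue`
(`modeQuad_weak`) and are pairwise orthogonal. At `h = 0` they are a Hilbert basis (`neumannBasis`),
so the Dirichlet form is at least `2p² + 1` times the squared norm on functions orthogonal to the
products with `a² + b² ≤ 2p²` (`neumann_poincare`). The Robin form dominates the Dirichlet form,
hence the Robin eigenspaces below `2p² + 1` have total dimension at most the number of such pairs.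
For small `h` the Robin products with these indices already fill that dimension, so they span
everything (`spectralSum_eq_span`); completeness for `h > 0` is never needed.

If `2p²` is a simple Neumann eigenvalue, the other low eigenvalues stay below `2p²` for small `h`,
while that of `(p, p)` is at least `2p²`. It is therefore simple, is the last of the low ones, and
its index is `(lowIndices p).card`. Its eigenfunctions are multiples of `f(x) f(y)`, where `f` has
`p + 1` nodal intervals, which gives `(p + 1)²` nodal domains. For (ii) the index exceeds `(p +
1)²`. -/

/-! ### One-dimensional Robin frequencies. -/

theorem sin_half_sub_of_even {n : ℕ} (hn : Even n) (a : ℝ) :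
    Real.sin (a / 2) = Real.cos (n * Real.pi / 2) * Real.sin ((a - n * Real.pi) / 2) ∧
    Real.cos (a / 2) = Real.cos (n * Real.pi / 2) * Real.cos ((a - n * Real.pi) / 2) ∧
    Real.cos (n * Real.pi / 2) ≠ 0 := by
  obtain ⟨k, rfl⟩ := hn
  have e : ((k + k : ℕ) : ℝ) * Real.pi / 2 = k * Real.pi := by push_cast; ring
  have e2 : a / 2 = (a - ((k + k : ℕ) : ℝ) * Real.pi) / 2 + k * Real.pi := by push_cast; ring
  have s := Real.sin_nat_mul_pi k
  have c := Real.sin_sq_add_cos_sq (k * Real.pi)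
  rw [e]
  refine ⟨?_, ?_, ?_⟩
  · rw [e2, Real.sin_add, s]; ring_nf
  · rw [e2, Real.cos_add, s]; ring_nf
  · intro h; rw [s, h] at c; norm_num at c

theorem sin_half_sub_of_odd {n : ℕ} (hn : ¬ Even n) (a : ℝ) :
    Real.sin (a / 2) = Real.sin (n * Real.pi / 2) * Real.cos ((a - n * Real.pi) / 2) ∧
    Real.cos (a / 2) = -(Real.sin (n * Real.pi / 2) * Real.sin ((a - n * Real.pi) / 2)) ∧
    Real.sin (n * Real.pi / 2) ≠ 0 := by
  obtain ⟨k, rfl⟩ := Nat.not_even_iff_odd.1 hn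
  have c0 : Real.cos (((2 * k + 1 : ℕ) : ℝ) * Real.pi / 2) = 0 := by
    rw [Real.cos_eq_zero_iff]; exact ⟨k, by push_cast; ring⟩
  have e2 : a / 2 = (a - ((2 * k + 1 : ℕ) : ℝ) * Real.pi) / 2 +
      ((2 * k + 1 : ℕ) : ℝ) * Real.pi / 2 := by ring
  have c := Real.sin_sq_add_cos_sq (((2 * k + 1 : ℕ) : ℝ) * Real.pi / 2)
  refine ⟨?_, ?_, ?_⟩
  · rw [e2, Real.sin_add, c0]; ring_nf
  · rw [e2, Real.cos_add, c0]; ring_nf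
  · intro h; rw [c0, h] at c; norm_num at c

/-- The equation defining `robinAlpha n h`, in the variable `a - nπ` and without the parity
distinction. -/
theorem robinAlpha_eq (n : ℕ) (h : ℝ) :
    robinAlpha n h = sInf {a : ℝ | a ∈ Ico (n * Real.pi) ((n + 1) * Real.pi) ∧
      a * Real.sin ((a - n * Real.pi) / 2) = h * Real.pi * Real.cos ((a - n * Real.pi) / 2)} := by
  unfold robinAlpha
  congr 1
  ext a
  simp only [mem_ofPred_eq]
  refine and_congr_right fun _ => ?_
  split_ifs with hn
  · obtain ⟨h1, h2, h3⟩ := sin_half_sub_of_even hn a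
    rw [h1, h2]
    constructor
    · intro e; apply mul_left_cancel₀ h3; linear_combination e
    · intro e; linear_combination Real.cos (n * Real.pi / 2) * e
  · obtain ⟨h1, h2, h3⟩ := sin_half_sub_of_odd hn a
    rw [h1, h2]
    constructor
    · intro e; apply mul_left_cancel₀ h3; linear_combination -e
    · intro e; linear_combination -Real.sin (n * Real.pi / 2) * e

/-- Intermediate value theorem. The parameter `c` localises the root: `c = π` gives existence, small
`c` gives the limit as `h → 0`. -/
theorem exists_alpha (n : ℕ) {h c : ℝ} (hh : 0 ≤ h) (hc : 0 ≤ c) (hcπ : c ≤ Real.pi)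
    (hlt : h * Real.pi * Real.cos (c / 2) < (n * Real.pi + c) * Real.sin (c / 2)) :
    ∃ a ∈ Ico (n * Real.pi) (n * Real.pi + c),
      a * Real.sin ((a - n * Real.pi) / 2) = h * Real.pi * Real.cos ((a - n * Real.pi) / 2) := by
  have hπ := Real.pi_pos
  have hcont : ContinuousOn (fun a : ℝ => a * Real.sin ((a - n * Real.pi) / 2) -
      h * Real.pi * Real.cos ((a - n * Real.pi) / 2)) (Icc (n * Real.pi) (n * Real.pi + c)) := by
    fun_prop
  have hle : n * Real.pi ≤ n * Real.pi + c := by linarith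
  have := intermediate_value_Ico hle hcont
  obtain ⟨a, ha, e⟩ := this (show (0 : ℝ) ∈ _ by
    constructor
    · simp only [sub_self, zero_div, Real.sin_zero, Real.cos_zero]
      nlinarith
    · simp only [add_sub_cancel_left]
      linarith)
  exact ⟨a, ha, sub_eq_zero.1 e⟩

/-- The half-angle lies in `[0, π/2)`, where the sine side strictly increases and the cosine side
does not increase. -/
theorem alpha_unique (n : ℕ) {h a b : ℝ} (hh : 0 ≤ h)
    (ha : a ∈ Ico (n * Real.pi) ((n + 1) * Real.pi))
    (hb : b ∈ Ico (n * Real.pi) ((n + 1) * Real.pi))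
    (ea : a * Real.sin ((a - n * Real.pi) / 2) = h * Real.pi * Real.cos ((a - n * Real.pi) / 2))
    (eb : b * Real.sin ((b - n * Real.pi) / 2) = h * Real.pi * Real.cos ((b - n * Real.pi) / 2)) :
    a = b := by
  have hπ := Real.pi_pos
  have key : ∀ a b : ℝ, a ∈ Ico (n * Real.pi) ((n + 1) * Real.pi) →
      b ∈ Ico (n * Real.pi) ((n + 1) * Real.pi) →
      a * Real.sin ((a - n * Real.pi) / 2) = h * Real.pi * Real.cos ((a - n * Real.pi) / 2) →
      b * Real.sin ((b - n * Real.pi) / 2) = h * Real.pi * Real.cos ((b - n * Real.pi) / 2) →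
      ¬ a < b := by
    intro a b ⟨ha1, ha2⟩ ⟨hb1, hb2⟩ ea eb hab
    have hn : 0 ≤ (n : ℝ) * Real.pi := by positivity
    have s : Real.sin ((a - n * Real.pi) / 2) < Real.sin ((b - n * Real.pi) / 2) :=
      Real.sin_lt_sin_of_lt_of_le_pi_div_two (by linarith) (by linarith) (by linarith)
    have s0 : 0 ≤ Real.sin ((a - n * Real.pi) / 2) :=
      Real.sin_nonneg_of_nonneg_of_le_pi (by linarith) (by linarith)
    have c : Real.cos ((b - n * Real.pi) / 2) ≤ Real.cos ((a - n * Real.pi) / 2) :=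
      Real.cos_le_cos_of_nonneg_of_le_pi (by linarith) (by linarith) (by linarith)
    have c' := mul_le_mul_of_nonneg_left c (mul_nonneg hh hπ.le)
    have hlt : a * Real.sin ((a - n * Real.pi) / 2) < b * Real.sin ((b - n * Real.pi) / 2) := by
      have h1 := mul_le_mul_of_nonneg_right hab.le s0
      have h2 := mul_lt_mul_of_pos_left s (by linarith : 0 < b)
      linarith
    linarith
  exact le_antisymm (not_lt.1 (key b a hb ha eb ea)) (not_lt.1 (key a b ha hb ea eb))

theorem alpha_set_eq (n : ℕ) {h a : ℝ} (hh : 0 ≤ h)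
    (ha : a ∈ Ico (n * Real.pi) ((n + 1) * Real.pi))
    (ea : a * Real.sin ((a - n * Real.pi) / 2) = h * Real.pi * Real.cos ((a - n * Real.pi) / 2)) :
    robinAlpha n h = a := by
  rw [robinAlpha_eq]
  have : {a : ℝ | a ∈ Ico (n * Real.pi) ((n + 1) * Real.pi) ∧
      a * Real.sin ((a - n * Real.pi) / 2) = h * Real.pi * Real.cos ((a - n * Real.pi) / 2)} =
      {a} := by
    ext b
    simp only [mem_ofPred_eq, mem_singleton_iff]
    constructor
    · rintro ⟨hb, eb⟩; exact alpha_unique n hh hb ha eb ea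
    · rintro rfl; exact ⟨ha, ea⟩
  rw [this, csInf_singleton]

theorem robinAlpha_lt_add (n : ℕ) {h c : ℝ} (hh : 0 ≤ h) (hc : 0 ≤ c) (hcπ : c ≤ Real.pi)
    (hlt : h * Real.pi * Real.cos (c / 2) < (n * Real.pi + c) * Real.sin (c / 2)) :
    robinAlpha n h ∈ Ico (n * Real.pi) (n * Real.pi + c) ∧
    robinAlpha n h * Real.sin ((robinAlpha n h - n * Real.pi) / 2) =
      h * Real.pi * Real.cos ((robinAlpha n h - n * Real.pi) / 2) := by
  obtain ⟨a, ha, ea⟩ := exists_alpha n hh hc hcπ hlt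
  rw [alpha_set_eq n hh ⟨ha.1, by linarith [ha.2]⟩ ea]
  exact ⟨ha, ea⟩

theorem robinAlpha_spec (n : ℕ) {h : ℝ} (hh : 0 ≤ h) :
    robinAlpha n h ∈ Ico (n * Real.pi) ((n + 1) * Real.pi) ∧
    robinAlpha n h * Real.sin ((robinAlpha n h - n * Real.pi) / 2) =
      h * Real.pi * Real.cos ((robinAlpha n h - n * Real.pi) / 2) := by
  have hπ := Real.pi_pos
  have := robinAlpha_lt_add n hh hπ.le le_rfl (by simp; positivity)
  rwa [show (n : ℝ) * Real.pi + Real.pi = (n + 1) * Real.pi by ring] at this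

theorem robinAlpha_zero (n : ℕ) : robinAlpha n 0 = n * Real.pi :=
  alpha_set_eq n le_rfl ⟨le_rfl, by nlinarith [Real.pi_pos]⟩ (by simp)

theorem tendsto_robinAlpha (n : ℕ) :
    Tendsto (robinAlpha n) (𝓝[≥] 0) (𝓝 (n * Real.pi)) := by
  have hπ := Real.pi_pos
  rw [tendsto_order]
  constructor
  · intro a ha
    filter_upwards [self_mem_nhdsWithin] with h hh
    exact ha.trans_le (robinAlpha_spec n hh).1.1
  · intro a ha
    set c := min (a - n * Real.pi) Real.pi with hcdef
    have hc : 0 < c := lt_min (by linarith) hπ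
    have hcπ : c ≤ Real.pi := min_le_right _ _
    have hca : c ≤ a - n * Real.pi := min_le_left _ _
    have hpos : 0 < (n * Real.pi + c) * Real.sin (c / 2) :=
      mul_pos (by positivity) (Real.sin_pos_of_pos_of_lt_pi (by linarith) (by linarith))
    have ht : Tendsto (fun h : ℝ => h * Real.pi * Real.cos (c / 2)) (𝓝[≥] 0) (𝓝 0) := by
      have : Continuous fun h : ℝ => h * Real.pi * Real.cos (c / 2) := by fun_prop
      simpa using (this.tendsto 0).mono_left nhdsWithin_le_nhds
    filter_upwards [self_mem_nhdsWithin, ht.eventually_lt_const hpos] with h hh hlt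
    have := (robinAlpha_lt_add n hh hc.le hcπ hlt).1.2
    linarith

theorem robinAlpha_injective {h : ℝ} (hh : 0 ≤ h) {m n : ℕ}
    (e : robinAlpha m h ^ 2 = robinAlpha n h ^ 2) : m = n := by
  have hπ := Real.pi_pos
  obtain ⟨hm1, hm2⟩ := (robinAlpha_spec m hh).1
  obtain ⟨hn1, hn2⟩ := (robinAlpha_spec n hh).1
  have h1 : 0 ≤ robinAlpha m h := le_trans (by positivity) hm1
  have h2 : 0 ≤ robinAlpha n h := le_trans (by positivity) hn1
  have e' : robinAlpha m h = robinAlpha n h := by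
    rwa [pow_left_inj₀ h1 h2 two_ne_zero] at e
  rw [e'] at hm1 hm2
  have i1 : (m : ℝ) < n + 1 := lt_of_mul_lt_mul_right (hm1.trans_lt hn2) hπ.le
  have i2 : (n : ℝ) < m + 1 := lt_of_mul_lt_mul_right (hn1.trans_lt hm2) hπ.le
  have i1' : m < n + 1 := by exact_mod_cast i1
  have i2' : n < m + 1 := by exact_mod_cast i2
  omega

theorem pairEigenvalue_zero (a b : ℕ) : pairEigenvalue a b 0 = (a : ℝ) ^ 2 + (b : ℝ) ^ 2 := by
  rw [pairEigenvalue, robinAlpha_zero, robinAlpha_zero]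
  field_simp

theorem le_pairEigenvalue (a b : ℕ) {h : ℝ} (hh : 0 ≤ h) :
    (a : ℝ) ^ 2 + (b : ℝ) ^ 2 ≤ pairEigenvalue a b h := by
  have hπ := Real.pi_pos
  rw [pairEigenvalue, le_div_iff₀ (by positivity)]
  have h1 := pow_le_pow_left₀ (by positivity) (robinAlpha_spec a hh).1.1 2
  have h2 := pow_le_pow_left₀ (by positivity) (robinAlpha_spec b hh).1.1 2
  nlinarith

theorem tendsto_pairEigenvalue (a b : ℕ) :
    Tendsto (pairEigenvalue a b) (𝓝[≥] 0) (𝓝 ((a : ℝ) ^ 2 + (b : ℝ) ^ 2)) := by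
  have := (((tendsto_robinAlpha a).pow 2).add ((tendsto_robinAlpha b).pow 2)).div_const
    (Real.pi ^ 2)
  rw [← pairEigenvalue_zero, pairEigenvalue, robinAlpha_zero, robinAlpha_zero]
  exact this

/-! ### One-dimensional Robin modes. -/

/-- The `n`-th eigenfunction of the one-dimensional Robin problem on `(-π/2, π/2)`. -/
noncomputable def mode (n : ℕ) (h x : ℝ) : ℝ :=
  Real.cos (robinAlpha n h / Real.pi * x + n * Real.pi / 2)

/-- The derivative of `mode`. -/
noncomputable def modeDeriv (n : ℕ) (h x : ℝ) : ℝ :=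
  -(robinAlpha n h / Real.pi * Real.sin (robinAlpha n h / Real.pi * x + n * Real.pi / 2))

theorem contDiff_mode (n : ℕ) (h : ℝ) : ContDiff ℝ (⊤ : ℕ∞) (mode n h) := by
  unfold mode; fun_prop

@[fun_prop]
theorem continuous_mode (n : ℕ) (h : ℝ) : Continuous (mode n h) := (contDiff_mode n h).continuous

@[fun_prop]
theorem continuous_modeDeriv (n : ℕ) (h : ℝ) : Continuous (modeDeriv n h) := by
  unfold modeDeriv; fun_prop

theorem hasDerivAt_mode (n : ℕ) (h x : ℝ) : HasDerivAt (mode n h) (modeDeriv n h x) x := by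
  have h1 : HasDerivAt (fun x : ℝ => robinAlpha n h / Real.pi * x + n * Real.pi / 2)
      (robinAlpha n h / Real.pi) x := by
    simpa using ((hasDerivAt_id x).const_mul (robinAlpha n h / Real.pi)).add_const
      (n * Real.pi / 2)
  exact h1.cos.congr_deriv (by rw [modeDeriv]; ring)

theorem hasDerivAt_modeDeriv (n : ℕ) (h x : ℝ) :
    HasDerivAt (modeDeriv n h) (-((robinAlpha n h / Real.pi) ^ 2 * mode n h x)) x := by
  have h1 : HasDerivAt (fun x : ℝ => robinAlpha n h / Real.pi * x + n * Real.pi / 2)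
      (robinAlpha n h / Real.pi) x := by
    simpa using ((hasDerivAt_id x).const_mul (robinAlpha n h / Real.pi)).add_const
      (n * Real.pi / 2)
  exact (h1.sin.const_mul (robinAlpha n h / Real.pi)).neg.congr_deriv (by rw [mode]; ring)

/-- At this endpoint the phase is `-(α - nπ)/2`, so the Robin condition is the parity-free equation
for `α`. -/
theorem modeDeriv_left (n : ℕ) {h : ℝ} (hh : 0 ≤ h) :
    modeDeriv n h (-(Real.pi / 2)) = h * mode n h (-(Real.pi / 2)) := by
  have e := (robinAlpha_spec n hh).2
  have hπ := Real.pi_ne_zero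
  have a1 : robinAlpha n h / Real.pi * -(Real.pi / 2) + n * Real.pi / 2 =
      -((robinAlpha n h - n * Real.pi) / 2) := by field_simp; ring
  rw [mode, modeDeriv, a1, Real.sin_neg, Real.cos_neg]
  generalize (robinAlpha n h - n * Real.pi) / 2 = β at *
  field_simp
  linear_combination e

theorem modeDeriv_right (n : ℕ) {h : ℝ} (hh : 0 ≤ h) :
    modeDeriv n h (Real.pi / 2) = -(h * mode n h (Real.pi / 2)) := by
  have e := (robinAlpha_spec n hh).2
  have hπ := Real.pi_ne_zero
  have a1 : robinAlpha n h / Real.pi * (Real.pi / 2) + n * Real.pi / 2 =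
      (robinAlpha n h - n * Real.pi) / 2 + n * Real.pi := by field_simp; ring
  rw [mode, modeDeriv, a1, Real.sin_add, Real.cos_add, Real.sin_nat_mul_pi]
  generalize (robinAlpha n h - n * Real.pi) / 2 = β at *
  generalize Real.cos (n * Real.pi) = c
  field_simp
  linear_combination -c * e

instance : IsFiniteMeasure sideMeasure := ⟨by simp [sideMeasure]⟩

theorem integral_sideMeasure (f : ℝ → ℝ) :
    ∫ x, f x ∂sideMeasure = ∫ x in (-(Real.pi / 2))..(Real.pi / 2), f x := by
  rw [sideMeasure, intervalIntegral.integral_of_le (by linarith [Real.pi_pos]),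
    integral_Ioc_eq_integral_Ioo]

theorem mode_green (n : ℕ) {h : ℝ} (hh : 0 ≤ h) {ψ ψ' : ℝ → ℝ}
    (hψ : ∀ x, HasDerivAt ψ (ψ' x) x) (hc : Continuous ψ') :
    ∫ x, modeDeriv n h x * ψ' x ∂sideMeasure +
      h * (mode n h (Real.pi / 2) * ψ (Real.pi / 2) +
        mode n h (-(Real.pi / 2)) * ψ (-(Real.pi / 2))) =
    (robinAlpha n h / Real.pi) ^ 2 * ∫ x, mode n h x * ψ x ∂sideMeasure := by
  rw [integral_sideMeasure, integral_sideMeasure,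
    intervalIntegral.integral_mul_deriv_eq_deriv_mul (fun x _ => hasDerivAt_modeDeriv n h x)
      (fun x _ => hψ x) (Continuous.intervalIntegrable (by fun_prop) _ _)
      (hc.intervalIntegrable _ _), modeDeriv_left n hh, modeDeriv_right n hh,
    ← intervalIntegral.integral_const_mul, ← sub_eq_zero]
  simp only [neg_mul, intervalIntegral.integral_neg, mul_assoc]
  ring

/-- The left side of `mode_green` is symmetric in the two modes, whereas the frequencies differ. -/
theorem integral_mode_mul_mode {m n : ℕ} (hmn : m ≠ n) {h : ℝ} (hh : 0 ≤ h) :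
    ∫ x, mode m h x * mode n h x ∂sideMeasure = 0 := by
  have h1 := mode_green m hh (hasDerivAt_mode n h) (continuous_modeDeriv n h)
  have h2 := mode_green n hh (hasDerivAt_mode m h) (continuous_modeDeriv m h)
  simp only [mul_comm (modeDeriv n h _), mul_comm (mode n h _)] at h2
  have h3 : ((robinAlpha m h / Real.pi) ^ 2 - (robinAlpha n h / Real.pi) ^ 2) *
      ∫ x, mode m h x * mode n h x ∂sideMeasure = 0 := by linear_combination h2 - h1
  rcases mul_eq_zero.1 h3 with h4 | h4
  · refine absurd (robinAlpha_injective hh ?_) hmn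
    have hπ := Real.pi_ne_zero
    field_simp at h4
    linarith
  · exact h4

theorem mode_left_pos (n : ℕ) {h : ℝ} (hh : 0 ≤ h) : 0 < mode n h (-(Real.pi / 2)) := by
  have hπ := Real.pi_pos
  obtain ⟨h1, h2⟩ := (robinAlpha_spec n hh).1
  have a1 : robinAlpha n h / Real.pi * -(Real.pi / 2) + n * Real.pi / 2 =
      -((robinAlpha n h - n * Real.pi) / 2) := by field_simp; ring
  rw [mode, a1, Real.cos_neg]
  exact Real.cos_pos_of_mem_Ioo ⟨by linarith, by linarith⟩

theorem integral_mode_sq_pos (n : ℕ) {h : ℝ} (hh : 0 ≤ h) :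
    0 < ∫ x, mode n h x * mode n h x ∂sideMeasure := by
  rw [integral_sideMeasure]
  have hπ := Real.pi_pos
  exact intervalIntegral.integral_pos (by linarith) (by fun_prop)
    (fun x _ => mul_self_nonneg _)
    ⟨-(Real.pi / 2), ⟨le_rfl, by linarith⟩, mul_pos (mode_left_pos n hh) (mode_left_pos n hh)⟩

/-! ### Integration over the square and Green's identity. -/

theorem area_eq_prod : area = sideMeasure.prod sideMeasure := by
  rw [area, sideMeasure, square, Measure.prod_restrict, Measure.volume_eq_prod]

instance : IsFiniteMeasure area := by rw [area_eq_prod]; infer_instance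

theorem sideMeasure_memLp {f : ℝ → ℝ} (hf : Continuous f) : MemLp f 2 sideMeasure := by
  obtain ⟨C, hC⟩ := (isCompact_Icc (a := -(Real.pi / 2))
    (b := Real.pi / 2)).exists_bound_of_continuousOn hf.continuousOn
  refine MemLp.of_bound hf.aestronglyMeasurable C ?_
  exact (ae_restrict_mem measurableSet_Ioo).mono fun x hx => hC x (Ioo_subset_Icc_self hx)

theorem area_memLp {f : ℝ × ℝ → ℝ} (hf : Continuous f) : MemLp f 2 area := by
  obtain ⟨C, hC⟩ := ((isCompact_Icc (a := -(Real.pi / 2)) (b := Real.pi / 2)).prod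
    (isCompact_Icc (a := -(Real.pi / 2)) (b := Real.pi / 2))).exists_bound_of_continuousOn
    hf.continuousOn
  refine MemLp.of_bound hf.aestronglyMeasurable C ?_
  exact (ae_restrict_mem (measurableSet_Ioo.prod measurableSet_Ioo)).mono fun x hx =>
    hC x ⟨Ioo_subset_Icc_self hx.1, Ioo_subset_Icc_self hx.2⟩

theorem sideMeasure_integrable {f : ℝ → ℝ} (hf : Continuous f) : Integrable f sideMeasure :=
  (sideMeasure_memLp hf).integrable (by norm_num)

theorem area_integrable {f : ℝ × ℝ → ℝ} (hf : Continuous f) : Integrable f area :=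
  (area_memLp hf).integrable (by norm_num)

theorem map_integrable {f : ℝ × ℝ → ℝ} (hf : Continuous f) {g : ℝ → ℝ × ℝ} (hg : Continuous g) :
    Integrable f (sideMeasure.map g) :=
  (integrable_map_measure hf.aestronglyMeasurable hg.aemeasurable).2
    (sideMeasure_integrable (hf.comp hg))

theorem arcLength_integrable {f : ℝ × ℝ → ℝ} (hf : Continuous f) : Integrable f arcLength :=
  ((map_integrable hf (by fun_prop)).add_measure (map_integrable hf (by fun_prop))).add_measure
    ((map_integrable hf (by fun_prop)).add_measure (map_integrable hf (by fun_prop)))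

theorem arcLength_memLp {f : ℝ × ℝ → ℝ} (hf : Continuous f) : MemLp f 2 arcLength :=
  (memLp_two_iff_integrable_sq hf.aestronglyMeasurable).2 (arcLength_integrable (hf.pow 2))

theorem integral_arcLength {f : ℝ × ℝ → ℝ} (hf : Continuous f) :
    ∫ z, f z ∂arcLength =
      ∫ t, (f (Real.pi / 2, t) + f (-(Real.pi / 2), t)) ∂sideMeasure +
      ∫ t, (f (t, Real.pi / 2) + f (t, -(Real.pi / 2))) ∂sideMeasure := by
  have key : ∀ g : ℝ → ℝ × ℝ, Continuous g →
      ∫ z, f z ∂(sideMeasure.map g) = ∫ t, f (g t) ∂sideMeasure := fun g hg =>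
    integral_map hg.aemeasurable hf.aestronglyMeasurable
  rw [arcLength, integral_add_measure, integral_add_measure, integral_add_measure,
    key _ (by fun_prop), key _ (by fun_prop), key _ (by fun_prop), key _ (by fun_prop),
    integral_add, integral_add]
  all_goals first
    | exact sideMeasure_integrable (by fun_prop)
    | exact map_integrable hf (by fun_prop)
    | exact (map_integrable hf (by fun_prop)).add_measure (map_integrable hf (by fun_prop))

/-- Apply `mode_green` to the slices of `φ` in each variable, then integrate over the other by
Fubini. -/
theorem mode_prod_green (a b : ℕ) {h : ℝ} (hh : 0 ≤ h) {φ : ℝ × ℝ → ℝ}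
    (hφ : ContDiff ℝ (⊤ : ℕ∞) φ) :
    ∫ z, modeDeriv a h z.1 * mode b h z.2 * fderiv ℝ φ z (1, 0) ∂area +
      ∫ z, mode a h z.1 * modeDeriv b h z.2 * fderiv ℝ φ z (0, 1) ∂area +
      h * ∫ z, mode a h z.1 * mode b h z.2 * φ z ∂arcLength =
    pairEigenvalue a b h * ∫ z, mode a h z.1 * mode b h z.2 * φ z ∂area := by
  have cφ : Continuous φ := hφ.continuous
  have cd : Continuous (fderiv ℝ φ) := hφ.continuous_fderiv (by simp)
  have c1 : Continuous fun z => fderiv ℝ φ z (1, 0) := cd.clm_apply continuous_const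
  have c2 : Continuous fun z => fderiv ℝ φ z (0, 1) := cd.clm_apply continuous_const
  have d : ∀ z, HasFDerivAt φ (fderiv ℝ φ z) z := fun z =>
    (hφ.differentiable (by simp) z).hasFDerivAt
  have d1 : ∀ y x, HasDerivAt (fun x => φ (x, y)) (fderiv ℝ φ (x, y) (1, 0)) x := fun y x =>
    (d (x, y)).comp_hasDerivAt x ((hasDerivAt_id x).prodMk (hasDerivAt_const x y))
  have d2 : ∀ x y, HasDerivAt (fun y => φ (x, y)) (fderiv ℝ φ (x, y) (0, 1)) y := fun x y =>
    (d (x, y)).comp_hasDerivAt y ((hasDerivAt_const y x).prodMk (hasDerivAt_id y))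
  have fub : ∀ f : ℝ × ℝ → ℝ, Continuous f →
      ∫ z, f z ∂area = ∫ x, ∫ y, f (x, y) ∂sideMeasure ∂sideMeasure := fun f hf => by
    have := area_integrable hf
    rw [area_eq_prod] at this ⊢
    exact integral_prod f this
  have fub' : ∀ f : ℝ × ℝ → ℝ, Continuous f →
      ∫ z, f z ∂area = ∫ y, ∫ x, f (x, y) ∂sideMeasure ∂sideMeasure := fun f hf => by
    have := area_integrable hf
    rw [area_eq_prod] at this ⊢
    exact integral_prod_symm f this
  have inn : ∀ f : ℝ × ℝ → ℝ, Continuous f →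
      Integrable (fun x => ∫ y, f (x, y) ∂sideMeasure) sideMeasure := fun f hf => by
    have := area_integrable hf
    rw [area_eq_prod] at this
    exact this.integral_prod_left
  have inn' : ∀ f : ℝ × ℝ → ℝ, Continuous f →
      Integrable (fun y => ∫ x, f (x, y) ∂sideMeasure) sideMeasure := fun f hf => by
    have := area_integrable hf
    rw [area_eq_prod] at this
    exact this.integral_prod_right
  have i1 : ∫ z, modeDeriv a h z.1 * mode b h z.2 * fderiv ℝ φ z (1, 0) ∂area +
      h * ∫ y, (mode a h (Real.pi / 2) * mode b h y * φ (Real.pi / 2, y) +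
        mode a h (-(Real.pi / 2)) * mode b h y * φ (-(Real.pi / 2), y)) ∂sideMeasure =
      (robinAlpha a h / Real.pi) ^ 2 * ∫ z, mode a h z.1 * mode b h z.2 * φ z ∂area := by
    rw [fub' _ (by fun_prop), fub' _ (by fun_prop), ← integral_const_mul, ← integral_const_mul,
      ← integral_add (inn' (fun z => modeDeriv a h z.1 * mode b h z.2 * fderiv ℝ φ z (1, 0))
        (by fun_prop)) (sideMeasure_integrable (by fun_prop))]
    refine integral_congr_ae (Eventually.of_forall fun y => ?_)
    have := mode_green a hh (d1 y) (by fun_prop)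
    dsimp only
    simp only [mul_right_comm _ (mode b h y), integral_mul_const]
    linear_combination mode b h y * this
  have i2 : ∫ z, mode a h z.1 * modeDeriv b h z.2 * fderiv ℝ φ z (0, 1) ∂area +
      h * ∫ x, (mode a h x * mode b h (Real.pi / 2) * φ (x, Real.pi / 2) +
        mode a h x * mode b h (-(Real.pi / 2)) * φ (x, -(Real.pi / 2))) ∂sideMeasure =
      (robinAlpha b h / Real.pi) ^ 2 * ∫ z, mode a h z.1 * mode b h z.2 * φ z ∂area := by
    rw [fub _ (by fun_prop), fub _ (by fun_prop), ← integral_const_mul, ← integral_const_mul,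
      ← integral_add (inn (fun z => mode a h z.1 * modeDeriv b h z.2 * fderiv ℝ φ z (0, 1))
        (by fun_prop)) (sideMeasure_integrable (by fun_prop))]
    refine integral_congr_ae (Eventually.of_forall fun x => ?_)
    have := mode_green b hh (d2 x) (by fun_prop)
    dsimp only
    simp only [mul_assoc (mode a h x), integral_const_mul]
    linear_combination mode a h x * this
  rw [integral_arcLength (by fun_prop), pairEigenvalue]
  have hπ := Real.pi_ne_zero
  have e : (robinAlpha a h ^ 2 + robinAlpha b h ^ 2) / Real.pi ^ 2 =
    (robinAlpha a h / Real.pi) ^ 2 + (robinAlpha b h / Real.pi) ^ 2 := by ring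
  rw [e]
  linear_combination i1 + i2

/-! ### Product modes as weak eigenfunctions. -/

/-- The products of one-dimensional modes, as functions on the plane. -/
noncomputable def modeProd (a b : ℕ) (h : ℝ) (z : ℝ × ℝ) : ℝ := mode a h z.1 * mode b h z.2

@[fun_prop]
theorem continuous_modeProd (a b : ℕ) (h : ℝ) : Continuous (modeProd a b h) := by
  unfold modeProd; fun_prop

/-- The product of two modes with its gradient and its boundary trace. -/
noncomputable def modeQuad (a b : ℕ) (h : ℝ) : L2S × L2S × L2S × L2B :=
  ((area_memLp (continuous_modeProd a b h)).toLp _,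
    (area_memLp (f := fun z => modeDeriv a h z.1 * mode b h z.2) (by fun_prop)).toLp _,
    (area_memLp (f := fun z => mode a h z.1 * modeDeriv b h z.2) (by fun_prop)).toLp _,
    (arcLength_memLp (continuous_modeProd a b h)).toLp _)

theorem modeQuad_fst_ae (a b : ℕ) (h : ℝ) : (modeQuad a b h).1 =ᵐ[area] modeProd a b h :=
  (area_memLp (continuous_modeProd a b h)).coeFn_toLp

theorem modeQuad_partial₁_ae (a b : ℕ) (h : ℝ) :
    (modeQuad a b h).2.1 =ᵐ[area] fun z => modeDeriv a h z.1 * mode b h z.2 :=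
  (area_memLp (f := fun z => modeDeriv a h z.1 * mode b h z.2) (by fun_prop)).coeFn_toLp

theorem modeQuad_partial₂_ae (a b : ℕ) (h : ℝ) :
    (modeQuad a b h).2.2.1 =ᵐ[area] fun z => mode a h z.1 * modeDeriv b h z.2 :=
  (area_memLp (f := fun z => mode a h z.1 * modeDeriv b h z.2) (by fun_prop)).coeFn_toLp

theorem modeQuad_trace_ae (a b : ℕ) (h : ℝ) :
    (modeQuad a b h).2.2.2 =ᵐ[arcLength] modeProd a b h :=
  (arcLength_memLp (continuous_modeProd a b h)).coeFn_toLp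

theorem modeQuad_mem_H1 (a b : ℕ) (h : ℝ) : modeQuad a b h ∈ H1 := by
  apply Submodule.le_topologicalClosure
  have d : ∀ z : ℝ × ℝ, HasFDerivAt (modeProd a b h)
      (mode a h z.1 • (modeDeriv b h z.2 • ContinuousLinearMap.snd ℝ ℝ ℝ) +
        mode b h z.2 • (modeDeriv a h z.1 • ContinuousLinearMap.fst ℝ ℝ ℝ)) z := fun z =>
    ((hasDerivAt_mode a h z.1).comp_hasFDerivAt z hasFDerivAt_fst).mul
      ((hasDerivAt_mode b h z.2).comp_hasFDerivAt z hasFDerivAt_snd)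
  refine ⟨modeProd a b h, ?_, modeQuad_fst_ae a b h, ?_, ?_, modeQuad_trace_ae a b h⟩
  · exact ((contDiff_mode a h).comp contDiff_fst).mul ((contDiff_mode b h).comp contDiff_snd)
  · refine (modeQuad_partial₁_ae a b h).trans (Eventually.of_forall fun z => ?_)
    simp [(d z).fderiv, mul_comm]
  · refine (modeQuad_partial₂_ae a b h).trans (Eventually.of_forall fun z => ?_)
    simp [(d z).fderiv]

theorem inner_eq_integral {α : Type*} [MeasurableSpace α] {μ : Measure α} {F G : Lp ℝ 2 μ}
    {f g : α → ℝ} (hf : F =ᵐ[μ] f) (hg : G =ᵐ[μ] g) : inner ℝ F G = ∫ z, f z * g z ∂μ := by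
  rw [L2.inner_def]
  refine integral_congr_ae ?_
  filter_upwards [hf, hg] with z h1 h2
  simp [h1, h2, mul_comm]

/-- Both sides are continuous in `V`, so smooth test functions suffice. -/
theorem modeQuad_weak (a b : ℕ) {h : ℝ} (hh : 0 ≤ h) {V : L2S × L2S × L2S × L2B} (hV : V ∈ H1) :
    robinForm h (modeQuad a b h) V = pairEigenvalue a b h * inner ℝ (modeQuad a b h).1 V.1 := by
  have hcl : IsClosed {V : L2S × L2S × L2S × L2B | robinForm h (modeQuad a b h) V =
      pairEigenvalue a b h * inner ℝ (modeQuad a b h).1 V.1} := by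
    unfold robinForm
    exact isClosed_eq (by fun_prop) (by fun_prop)
  have hV' : V ∈ closure (smoothGraph : Set (L2S × L2S × L2S × L2B)) := hV
  refine closure_minimal ?_ hcl hV'
  rintro W ⟨φ, hφ, h1, h2, h3, h4⟩
  have := mode_prod_green a b hh hφ
  simp only [mem_ofPred_eq, robinForm]
  rw [inner_eq_integral (modeQuad_fst_ae a b h) h1,
    inner_eq_integral (modeQuad_partial₁_ae a b h) h2,
    inner_eq_integral (modeQuad_partial₂_ae a b h) h3,
    inner_eq_integral (modeQuad_trace_ae a b h) h4]
  exact this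

theorem modeQuad_mem_eigenspace (a b : ℕ) {h : ℝ} (hh : 0 ≤ h) :
    (modeQuad a b h).1 ∈ eigenspace h (pairEigenvalue a b h) :=
  ⟨_, modeQuad_mem_H1 a b h, rfl, fun _ hV => modeQuad_weak a b hh hV⟩

theorem robinForm_comm (h : ℝ) (u v : L2S × L2S × L2S × L2B) :
    robinForm h u v = robinForm h v u := by
  simp only [robinForm, real_inner_comm]

theorem robinForm_nonneg (h : ℝ) (hh : 0 ≤ h) (u : L2S × L2S × L2S × L2B) :
    0 ≤ robinForm h u u := by
  have h1 := real_inner_self_nonneg (x := u.2.1)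
  have h2 := real_inner_self_nonneg (x := u.2.2.1)
  have h3 := mul_nonneg hh (real_inner_self_nonneg (x := u.2.2.2))
  unfold robinForm
  linarith

theorem robinForm_zero_le {h : ℝ} (hh : 0 ≤ h) (u : L2S × L2S × L2S × L2B) :
    robinForm 0 u u ≤ robinForm h u u := by
  have h3 := mul_nonneg hh (real_inner_self_nonneg (x := u.2.2.2))
  unfold robinForm
  linarith

theorem inner_eigenspace {h lam mu : ℝ} (hne : lam ≠ mu) {u v : L2S} (hu : u ∈ eigenspace h lam)
    (hv : v ∈ eigenspace h mu) : inner ℝ u v = 0 := by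
  obtain ⟨U, hU, rfl, h1⟩ := hu
  obtain ⟨V, hV, rfl, h2⟩ := hv
  have e1 := h1 V hV
  have e2 := h2 U hU
  rw [robinForm_comm, real_inner_comm] at e2
  have : (lam - mu) * inner ℝ U.1 V.1 = 0 := by linear_combination e2 - e1
  exact (mul_eq_zero.1 this).resolve_left (sub_ne_zero.2 hne)

theorem inner_modeQuad (a b c d : ℕ) (h : ℝ) :
    inner ℝ (modeQuad a b h).1 (modeQuad c d h).1 =
      (∫ x, mode a h x * mode c h x ∂sideMeasure) *
        ∫ x, mode b h x * mode d h x ∂sideMeasure := by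
  rw [inner_eq_integral (modeQuad_fst_ae a b h) (modeQuad_fst_ae c d h), area_eq_prod,
    ← integral_prod_mul]
  refine integral_congr_ae (Eventually.of_forall fun z => ?_)
  simp only [modeProd]; ring

theorem inner_modeQuad_self_pos (a b : ℕ) {h : ℝ} (hh : 0 ≤ h) :
    0 < inner ℝ (modeQuad a b h).1 (modeQuad a b h).1 := by
  rw [inner_modeQuad]
  exact mul_pos (integral_mode_sq_pos a hh) (integral_mode_sq_pos b hh)

theorem inner_modeQuad_of_ne {a b c d : ℕ} (hne : (a, b) ≠ (c, d)) {h : ℝ} (hh : 0 ≤ h) :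
    inner ℝ (modeQuad a b h).1 (modeQuad c d h).1 = 0 := by
  rw [inner_modeQuad]
  by_cases hac : a = c
  · have hbd : b ≠ d := fun e => hne (by rw [hac, e])
    rw [integral_mode_mul_mode hbd hh, mul_zero]
  · rw [integral_mode_mul_mode hac hh, zero_mul]

theorem modeQuad_fst_ne_zero (a b : ℕ) {h : ℝ} (hh : 0 ≤ h) : (modeQuad a b h).1 ≠ 0 := by
  intro e
  have := inner_modeQuad_self_pos a b hh
  rw [e, inner_zero_left] at this
  exact this.false

theorem linearIndependent_modeQuad {h : ℝ} (hh : 0 ≤ h) :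
    LinearIndependent ℝ fun i : ℕ × ℕ => (modeQuad i.1 i.2 h).1 :=
  linearIndependent_of_ne_zero_of_inner_eq_zero (fun i => modeQuad_fst_ne_zero i.1 i.2 hh)
    fun _ _ hij => inner_modeQuad_of_ne hij hh

/-! ### Completeness of the Neumann products. -/

theorem mode_zero (n : ℕ) (x : ℝ) : mode n 0 x = Real.cos (n * (x + Real.pi / 2)) := by
  have hπ := Real.pi_ne_zero
  rw [mode, robinAlpha_zero]
  congr 1
  field_simp

/-- The closed square. -/
abbrev closedSquare : Set (ℝ × ℝ) :=
  Icc (-(Real.pi / 2)) (Real.pi / 2) ×ˢ Icc (-(Real.pi / 2)) (Real.pi / 2)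

instance : CompactSpace closedSquare :=
  isCompact_iff_compactSpace.1 (isCompact_Icc.prod isCompact_Icc)

/-- The Neumann products as continuous functions on the closed square. -/
noncomputable def cosProd (i : ℕ × ℕ) : C(closedSquare, ℝ) where
  toFun z := Real.cos (i.1 * (z.1.1 + Real.pi / 2)) * Real.cos (i.2 * (z.1.2 + Real.pi / 2))

/-- `max m n - min m n` is `|m - n|` as a natural number, which keeps the product formula within the
index set of `cosProd`. -/
theorem cos_mul_cos_nat (m n : ℕ) (x : ℝ) :
    Real.cos (m * x) * Real.cos (n * x) =
      (Real.cos ((m + n : ℕ) * x) + Real.cos (((max m n - min m n : ℕ) : ℝ) * x)) / 2 := by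
  have hc : Real.cos (((max m n - min m n : ℕ) : ℝ) * x) = Real.cos (m * x - n * x) := by
    rcases le_total m n with hmn | hmn
    · rw [max_eq_right hmn, min_eq_left hmn, Nat.cast_sub hmn, ← Real.cos_neg]; ring_nf
    · rw [max_eq_left hmn, min_eq_right hmn, Nat.cast_sub hmn]; ring_nf
  rw [hc, Nat.cast_add, add_mul, Real.cos_add, Real.cos_sub]
  ring

theorem cosProd_mul_mem (i j : ℕ × ℕ) :
    cosProd i * cosProd j ∈ Submodule.span ℝ (range cosProd) := by
  have : cosProd i * cosProd j = (1 / 4 : ℝ) • (cosProd (i.1 + j.1, i.2 + j.2) +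
      cosProd (i.1 + j.1, max i.2 j.2 - min i.2 j.2) +
      cosProd (max i.1 j.1 - min i.1 j.1, i.2 + j.2) +
      cosProd (max i.1 j.1 - min i.1 j.1, max i.2 j.2 - min i.2 j.2)) := by
    ext z
    have h1 := cos_mul_cos_nat i.1 j.1 (z.1.1 + Real.pi / 2)
    have h2 := cos_mul_cos_nat i.2 j.2 (z.1.2 + Real.pi / 2)
    simp only [cosProd, ContinuousMap.mul_apply, ContinuousMap.coe_mk, ContinuousMap.smul_apply,
      ContinuousMap.add_apply, smul_eq_mul]
    rw [mul_mul_mul_comm, h1, h2]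
    ring
  rw [this]
  have m : ∀ k, cosProd k ∈ Submodule.span ℝ (range cosProd) := fun k =>
    Submodule.subset_span ⟨k, rfl⟩
  exact Submodule.smul_mem _ _ (add_mem (add_mem (add_mem (m _) (m _)) (m _)) (m _))

/-- The algebra of trigonometric polynomials spanned by the Neumann products. -/
noncomputable def cosAlgebra : Subalgebra ℝ C(closedSquare, ℝ) :=
  (Submodule.span ℝ (range cosProd)).toSubalgebra
    (Submodule.subset_span ⟨0, by ext; simp [cosProd]⟩)
    (fun f g hf hg => by
      have := Submodule.mul_mem_mul hf hg
      rw [Submodule.span_mul_span] at this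
      refine Submodule.span_le.2 ?_ this
      rintro _ ⟨_, ⟨i, rfl⟩, _, ⟨j, rfl⟩, rfl⟩
      exact cosProd_mul_mem i j)

theorem cosAlgebra_separatesPoints : cosAlgebra.SeparatesPoints := by
  have m : ∀ k, cosProd k ∈ cosAlgebra := fun k => Submodule.subset_span ⟨k, rfl⟩
  intro z w hzw
  have inj : ∀ x ∈ Icc (-(Real.pi / 2)) (Real.pi / 2), ∀ y ∈ Icc (-(Real.pi / 2)) (Real.pi / 2),
      Real.cos (x + Real.pi / 2) = Real.cos (y + Real.pi / 2) → x = y := fun x hx y hy e => by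
    have := Real.injOn_cos ⟨by linarith [hx.1], by linarith [hx.2]⟩
      ⟨by linarith [hy.1], by linarith [hy.2]⟩ e
    linarith
  by_cases h1 : z.1.1 = w.1.1
  · refine ⟨_, ⟨_, m (0, 1), rfl⟩, fun e => hzw (Subtype.ext (Prod.ext h1 ?_))⟩
    exact inj _ z.2.2 _ w.2.2 (by simpa [cosProd] using e)
  · refine ⟨_, ⟨_, m (1, 0), rfl⟩, fun e => h1 ?_⟩
    exact inj _ z.2.1 _ w.2.1 (by simpa [cosProd] using e)

/-- By Stone–Weierstrass on the closed square, `u` integrates to zero against every continuous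
function, in particular against test functions supported in the open square. -/
theorem eq_zero_of_inner_modeQuad_eq_zero {u : L2S}
    (hu : ∀ a b, inner ℝ (modeQuad a b 0).1 u = 0) : u = 0 := by
  have hui : Integrable u area := (Lp.memLp u).integrable (by norm_num)
  have hms : MeasurableSet square := measurableSet_Ioo.prod measurableSet_Ioo
  have hmem : ∀ᵐ z ∂area, z ∈ closedSquare := (ae_restrict_mem hms).mono fun z hz =>
    ⟨Ioo_subset_Icc_self hz.1, Ioo_subset_Icc_self hz.2⟩
  have hprod : ∀ P : ℝ × ℝ → ℝ, Continuous P → Integrable (fun z => P z * u z) area :=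
    fun P hP => (area_memLp hP).integrable_mul (Lp.memLp u)
  have hspan : ∀ f ∈ Submodule.span ℝ (range cosProd), ∃ P : ℝ × ℝ → ℝ, Continuous P ∧
      (∀ z : closedSquare, P z = f z) ∧ ∫ z, P z * u z ∂area = 0 := by
    intro f hf
    induction hf using Submodule.span_induction with
    | mem f hf =>
      obtain ⟨i, rfl⟩ := hf
      refine ⟨modeProd i.1 i.2 0, by fun_prop, fun z => ?_, ?_⟩
      · simp [modeProd, mode_zero, cosProd]
      · exact (inner_eq_integral (modeQuad_fst_ae _ _ _) (ae_eq_refl _)).symm.trans (hu i.1 i.2)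
    | zero => exact ⟨0, continuous_zero, fun z => rfl, by simp⟩
    | add f g _ _ hf hg =>
      obtain ⟨P, hP, h1, h2⟩ := hf
      obtain ⟨Q, hQ, h3, h4⟩ := hg
      refine ⟨P + Q, hP.add hQ, fun z => by simp [h1, h3], ?_⟩
      simp only [Pi.add_apply, add_mul]
      rw [integral_add (hprod P hP) (hprod Q hQ), h2, h4, add_zero]
    | smul c f _ hf =>
      obtain ⟨P, hP, h1, h2⟩ := hf
      refine ⟨c • P, continuous_const.smul hP, fun z => by simp [h1], ?_⟩
      simp only [Pi.smul_apply, smul_eq_mul, mul_assoc]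
      rw [integral_const_mul, h2, mul_zero]
  have hcont : ∀ g : ℝ × ℝ → ℝ, Continuous g → ∫ z, g z * u z ∂area = 0 := by
    intro g hg
    by_contra hne
    set I := ∫ z, |u z| ∂area with hI
    have hI0 : 0 ≤ I := integral_nonneg fun _ => abs_nonneg _
    have hpos : 0 < |∫ z, g z * u z ∂area| := abs_pos.2 hne
    -- With `δ` the absolute value of the integral, accuracy `δ/(I + 1)` bounds `δ` by `δI/(I + 1) <
    -- δ`; the `+ 1` also covers `I = 0`.
    obtain ⟨f, hf⟩ :=
      ContinuousMap.exists_mem_subalgebra_near_continuousMap_of_separatesPoints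
      cosAlgebra cosAlgebra_separatesPoints ⟨fun z : closedSquare => g z, by fun_prop⟩
      (|∫ z, g z * u z ∂area| / (I + 1)) (by positivity)
    obtain ⟨P, hP, h1, h2⟩ := hspan f.1 f.2
    have e : ∫ z, g z * u z ∂area = ∫ z, (g z - P z) * u z ∂area := by
      simp only [sub_mul]
      rw [integral_sub (hprod g hg) (hprod P hP), h2, sub_zero]
    have b : |∫ z, (g z - P z) * u z ∂area| ≤ |∫ z, g z * u z ∂area| / (I + 1) * I := by
      rw [hI, ← integral_const_mul]
      refine (abs_integral_le_integral_abs).trans (integral_mono_ae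
        (hprod _ (hg.sub hP)).abs (hui.abs.const_mul _) ?_)
      filter_upwards [hmem] with z hz
      rw [abs_mul]
      refine mul_le_mul_of_nonneg_right ?_ (abs_nonneg _)
      have := (ContinuousMap.norm_coe_le_norm _ (⟨z, hz⟩ : closedSquare)).trans hf.le
      rw [abs_sub_comm, h1 ⟨z, hz⟩]
      exact this
    rw [← e, div_mul_eq_mul_div, le_div_iff₀ (by positivity)] at b
    nlinarith
  have hopen : IsOpen square := isOpen_Ioo.prod isOpen_Ioo
  have hz := hopen.ae_eq_zero_of_integral_contDiff_smul_eq_zero (μ := volume) (f := u)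
    (IntegrableOn.locallyIntegrableOn hui) (fun g hg _ hsupp => by
      rw [← hcont g hg.continuous]
      symm
      refine setIntegral_eq_integral_of_forall_compl_eq_zero fun z hz => ?_
      rw [image_eq_zero_of_notMem_tsupport fun h' => hz (hsupp h'), zero_mul])
  refine Lp.ext ?_
  filter_upwards [(ae_restrict_iff' hms).2 hz, Lp.coeFn_zero ℝ 2 area] with z h1 h2
  rw [h1, h2]; rfl

/-- The normalising factor of the Neumann products. -/
noncomputable def neumannScale (i : ℕ × ℕ) : ℝ := ‖(modeQuad i.1 i.2 0).1‖⁻¹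

/-- The Neumann products, normalised in `L²(S)`. -/
noncomputable def neumannQuad (i : ℕ × ℕ) : L2S × L2S × L2S × L2B :=
  neumannScale i • modeQuad i.1 i.2 0

theorem neumannQuad_fst (i : ℕ × ℕ) :
    (neumannQuad i).1 = neumannScale i • (modeQuad i.1 i.2 0).1 := rfl

theorem neumannQuad_mem_H1 (i : ℕ × ℕ) : neumannQuad i ∈ H1 :=
  H1.smul_mem _ (modeQuad_mem_H1 _ _ _)

theorem neumannQuad_weak (i : ℕ × ℕ) {V : L2S × L2S × L2S × L2B} (hV : V ∈ H1) :
    robinForm 0 (neumannQuad i) V =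
      ((i.1 : ℝ) ^ 2 + (i.2 : ℝ) ^ 2) * inner ℝ (neumannQuad i).1 V.1 := by
  have := modeQuad_weak i.1 i.2 le_rfl hV
  rw [pairEigenvalue_zero] at this
  simp only [robinForm, neumannQuad, Prod.smul_fst, Prod.smul_snd, real_inner_smul_left] at this ⊢
  linear_combination neumannScale i * this

theorem orthonormal_neumannQuad : Orthonormal ℝ fun i => (neumannQuad i).1 := by
  constructor
  · intro i
    dsimp only
    rw [neumannQuad_fst, norm_smul, neumannScale, norm_inv, norm_norm,
      inv_mul_cancel₀ (norm_ne_zero_iff.2 (modeQuad_fst_ne_zero _ _ le_rfl))]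
  · intro i j hij
    dsimp only
    rw [neumannQuad_fst, neumannQuad_fst, real_inner_smul_left, real_inner_smul_right,
      inner_modeQuad_of_ne hij le_rfl, mul_zero, mul_zero]

theorem neumannScale_ne_zero (i : ℕ × ℕ) : neumannScale i ≠ 0 :=
  inv_ne_zero (norm_ne_zero_iff.2 (modeQuad_fst_ne_zero _ _ le_rfl))

/-- The Hilbert basis of `L²(S)` consisting of the Neumann eigenfunctions. -/
noncomputable def neumannBasis : HilbertBasis (ℕ × ℕ) ℝ L2S :=
  HilbertBasis.mkOfOrthogonalEqBot orthonormal_neumannQuad (by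
    rw [Submodule.eq_bot_iff]
    intro u hu
    refine eq_zero_of_inner_modeQuad_eq_zero fun a b => ?_
    have := (Submodule.mem_orthogonal _ _).1 hu (neumannQuad (a, b)).1
      (Submodule.subset_span ⟨(a, b), rfl⟩)
    rw [neumannQuad_fst, real_inner_smul_left] at this
    exact (mul_eq_zero.1 this).resolve_left (neumannScale_ne_zero _))

/-- Removing the component of `U` along a basis element lowers the Dirichlet form by exactly the
corresponding summand and leaves the other coefficients unchanged; what remains is nonnegative. -/
theorem neumann_bessel (F : Finset (ℕ × ℕ)) {U : L2S × L2S × L2S × L2B} (hU : U ∈ H1) :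
    ∑ i ∈ F, ((i.1 : ℝ) ^ 2 + (i.2 : ℝ) ^ 2) * inner ℝ (neumannQuad i).1 U.1 ^ 2 ≤
      robinForm 0 U U := by
  induction F using Finset.induction_on generalizing U with
  | empty => simpa using robinForm_nonneg 0 le_rfl U
  | insert j F hj ih =>
    rw [Finset.sum_insert hj]
    set c : ℝ := inner ℝ (neumannQuad j).1 U.1 with hc
    have h1 := ih (H1.sub_mem hU (H1.smul_mem c (neumannQuad_mem_H1 j)))
    have e1 : ∀ i ∈ F, ((i.1 : ℝ) ^ 2 + (i.2 : ℝ) ^ 2) *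
        inner ℝ (neumannQuad i).1 (U - c • neumannQuad j).1 ^ 2 =
        ((i.1 : ℝ) ^ 2 + (i.2 : ℝ) ^ 2) * inner ℝ (neumannQuad i).1 U.1 ^ 2 := by
      intro i hi
      have hij : i ≠ j := fun e => hj (e ▸ hi)
      rw [Prod.fst_sub, Prod.smul_fst, inner_sub_right, real_inner_smul_right,
        orthonormal_neumannQuad.2 hij, mul_zero, sub_zero]
    rw [Finset.sum_congr rfl e1] at h1
    have w1 := neumannQuad_weak j hU
    have w2 := neumannQuad_weak j (neumannQuad_mem_H1 j)
    have n1 : inner ℝ (neumannQuad j).1 (neumannQuad j).1 = (1 : ℝ) := by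
      rw [real_inner_self_eq_norm_sq, orthonormal_neumannQuad.1 j, one_pow]
    have e2 : robinForm 0 (U - c • neumannQuad j) (U - c • neumannQuad j) =
        robinForm 0 U U - 2 * c * robinForm 0 (neumannQuad j) U +
          c ^ 2 * robinForm 0 (neumannQuad j) (neumannQuad j) := by
      simp only [robinForm, Prod.fst_sub, Prod.snd_sub, Prod.smul_fst, Prod.smul_snd,
        inner_sub_left, inner_sub_right, real_inner_smul_left, real_inner_smul_right,
        real_inner_comm U.2.1, real_inner_comm U.2.2.1]
      rw [real_inner_comm (neumannQuad j).2.1 U.2.1, real_inner_comm (neumannQuad j).2.2.1 U.2.2.1]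
      ring
    rw [e2, w1, w2, n1, ← hc] at h1
    linarith

/-- Parseval for `‖U‖²` is compared termwise with `neumann_bessel`; the terms with index in `S`
vanish. -/
theorem neumann_poincare (S : Finset (ℕ × ℕ)) {Λ : ℝ}
    (hS : ∀ i ∉ S, Λ ≤ (i.1 : ℝ) ^ 2 + (i.2 : ℝ) ^ 2) {U : L2S × L2S × L2S × L2B} (hU : U ∈ H1)
    (horth : ∀ i ∈ S, inner ℝ (modeQuad i.1 i.2 0).1 U.1 = 0) :
    Λ * inner ℝ U.1 U.1 ≤ robinForm 0 U U := by
  have hs := (neumannBasis.hasSum_inner_mul_inner U.1 U.1).mul_left Λ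
  refine hasSum_le_of_sum_le hs fun F => ?_
  refine le_trans (Finset.sum_le_sum fun i _ => ?_) (neumann_bessel F hU)
  have hb : neumannBasis i = (neumannQuad i).1 := by
    rw [neumannBasis, HilbertBasis.coe_mkOfOrthogonalEqBot]
  rw [hb, real_inner_comm, ← sq]
  by_cases hi : i ∈ S
  · rw [neumannQuad_fst, real_inner_smul_left, horth i hi]
    simp
  · exact mul_le_mul_of_nonneg_right (hS i hi) (sq_nonneg _)

/-! ### Counting Robin eigenvalues below `2p² + 1`. -/

/-- The index pairs of the Neumann eigenvalues `a² + b² ≤ 2p²`. -/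
def lowIndices (p : ℕ) : Finset (ℕ × ℕ) :=
  (Finset.range (2 * p + 1) ×ˢ Finset.range (2 * p + 1)).filter
    fun i => i.1 ^ 2 + i.2 ^ 2 ≤ 2 * p ^ 2

/-- The box only provides finiteness: `a² ≤ 2p²` already forces `a ≤ 2p`. -/
theorem mem_lowIndices {p : ℕ} {i : ℕ × ℕ} :
    i ∈ lowIndices p ↔ i.1 ^ 2 + i.2 ^ 2 ≤ 2 * p ^ 2 := by
  simp only [lowIndices, Finset.mem_filter, Finset.mem_product, Finset.mem_range]
  refine ⟨fun h => h.2, fun h => ⟨⟨?_, ?_⟩, h⟩⟩ <;> nlinarith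

theorem diag_mem_lowIndices (p : ℕ) : (p, p) ∈ lowIndices p :=
  mem_lowIndices.2 (by dsimp only; omega)

/-- The sum of the eigenspaces of the eigenvalues `≤ lam`. -/
noncomputable abbrev spectralSum (h lam : ℝ) : Submodule ℝ L2S :=
  ⨆ (mu : ℝ) (_ : mu ≤ lam), eigenspace h mu

theorem eigenspace_le_spectralSum (h : ℝ) {mu lam : ℝ} (hle : mu ≤ lam) :
    eigenspace h mu ≤ spectralSum h lam :=
  le_iSup₂_of_le mu hle le_rfl

theorem spectralSum_mono (h : ℝ) {lam lam' : ℝ} (hle : lam ≤ lam') :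
    spectralSum h lam ≤ spectralSum h lam' :=
  iSup₂_le fun _ hmu => eigenspace_le_spectralSum h (hmu.trans hle)

theorem exists_sum_weak {ι : Type*} (h : ℝ) (mu : ι → ℝ) (f : ι → L2S)
    (hf : ∀ i, f i ∈ eigenspace h (mu i)) (F : Finset ι) :
    ∃ U ∈ H1, U.1 = ∑ i ∈ F, f i ∧
      ∀ V ∈ H1, robinForm h U V = ∑ i ∈ F, mu i * inner ℝ (f i) V.1 := by
  classical
  induction F using Finset.induction_on with
  | empty => exact ⟨0, H1.zero_mem, rfl, fun V _ => by simp [robinForm]⟩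
  | insert j F hj ih =>
    obtain ⟨U, hU, h1, h2⟩ := ih
    obtain ⟨W, hW, h3, h4⟩ := hf j
    refine ⟨W + U, H1.add_mem hW hU, by rw [Finset.sum_insert hj, Prod.fst_add, h1, h3],
      fun V hV => ?_⟩
    rw [Finset.sum_insert hj, ← h2 V hV, ← h3, ← h4 V hV]
    simp only [robinForm, Prod.fst_add, Prod.snd_add, inner_add_left]
    ring

/-- The summands from distinct eigenspaces are orthogonal, so form and squared norm both split as
sums over them. -/
theorem exists_robinForm_le {h lam : ℝ} {u : L2S} (hu : u ∈ spectralSum h lam) :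
    ∃ U ∈ H1, U.1 = u ∧ robinForm h U U ≤ lam * inner ℝ U.1 U.1 := by
  rw [spectralSum, iSup_subtype', Submodule.mem_iSup_iff_exists_finsupp] at hu
  obtain ⟨f, hf, hsum⟩ := hu
  obtain ⟨U, hU, h1, h2⟩ := exists_sum_weak h (fun i : {mu : ℝ // mu ≤ lam} => i.1) f hf f.support
  refine ⟨U, hU, h1.trans hsum, ?_⟩
  have hin : ∀ i ∈ f.support, inner ℝ (f i) U.1 = inner ℝ (f i) (f i) := by
    intro i hi
    rw [h1, inner_sum]
    refine Finset.sum_eq_single_of_mem i hi fun j _ hji => ?_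
    exact inner_eigenspace (fun e => hji (Subtype.ext e.symm)) (hf i) (hf j)
  have hself : inner ℝ U.1 U.1 = ∑ i ∈ f.support, inner ℝ (f i) (f i) := by
    nth_rewrite 1 [h1]
    rw [sum_inner]
    exact Finset.sum_congr rfl hin
  rw [h2 U hU, hself, Finset.mul_sum]
  refine Finset.sum_le_sum fun i hi => ?_
  rw [hin i hi]
  exact mul_le_mul_of_nonneg_right i.2 real_inner_self_nonneg

theorem eq_zero_of_mem_spectralSum {p : ℕ} {h lam : ℝ} (hh : 0 ≤ h)
    (hlam : lam < 2 * (p : ℝ) ^ 2 + 1) {u : L2S} (hu : u ∈ spectralSum h lam)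
    (horth : ∀ i ∈ lowIndices p, inner ℝ (modeQuad i.1 i.2 0).1 u = 0) : u = 0 := by
  obtain ⟨U, hU, rfl, hle⟩ := exists_robinForm_le hu
  -- Neumann eigenvalues are integers, so the first one above `2p²` is at least `2p² + 1`.
  have h1 := neumann_poincare (lowIndices p) (Λ := 2 * (p : ℝ) ^ 2 + 1) (fun i hi => by
    rw [mem_lowIndices, not_le] at hi
    exact_mod_cast hi) hU horth
  have h2 := robinForm_zero_le hh U
  have h3 := real_inner_self_nonneg (x := U.1)
  refine (inner_self_eq_zero (𝕜 := ℝ)).1 (le_antisymm ?_ h3)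
  nlinarith

/-- The Fourier coefficients of low order with respect to the Neumann products. -/
noncomputable def lowCoeff (p : ℕ) (T : Submodule ℝ L2S) : T →ₗ[ℝ] (lowIndices p → ℝ) :=
  LinearMap.pi fun i => (innerₛₗ ℝ (modeQuad i.1.1 i.1.2 0).1) ∘ₗ T.subtype

theorem lowCoeff_injective {p : ℕ} {h lam : ℝ} (hh : 0 ≤ h) (hlam : lam < 2 * (p : ℝ) ^ 2 + 1) :
    Function.Injective (lowCoeff p (spectralSum h lam)) := by
  rw [injective_iff_map_eq_zero]
  intro u hu
  refine Subtype.ext (eq_zero_of_mem_spectralSum hh hlam u.2 fun i hi => ?_)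
  exact congrFun hu ⟨i, hi⟩

theorem finiteDimensional_spectralSum {p : ℕ} {h lam : ℝ} (hh : 0 ≤ h)
    (hlam : lam < 2 * (p : ℝ) ^ 2 + 1) : FiniteDimensional ℝ (spectralSum h lam) :=
  FiniteDimensional.of_injective _ (lowCoeff_injective hh hlam)

theorem finrank_spectralSum_le {p : ℕ} {h lam : ℝ} (hh : 0 ≤ h)
    (hlam : lam < 2 * (p : ℝ) ^ 2 + 1) :
    Module.finrank ℝ (spectralSum h lam) ≤ (lowIndices p).card := by
  simpa using LinearMap.finrank_le_finrank_of_injective (lowCoeff_injective hh hlam)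

/-- The Robin products with low index. -/
noncomputable def lowMode (p : ℕ) (h : ℝ) (i : lowIndices p) : L2S :=
  (modeQuad i.1.1 i.1.2 h).1

theorem finrank_span_lowMode (p : ℕ) {h : ℝ} (hh : 0 ≤ h) :
    Module.finrank ℝ (Submodule.span ℝ (range (lowMode p h))) = (lowIndices p).card := by
  have : LinearIndependent ℝ (lowMode p h) :=
    (linearIndependent_modeQuad hh).comp _ Subtype.val_injective
  rw [finrank_span_eq_card this, Fintype.card_coe]

/-- Equality by dimension: independent Robin products from below, the Neumann coefficient map from
above. -/
theorem spectralSum_eq_span {p : ℕ} {h lam : ℝ} (hh : 0 ≤ h) (hlam : lam < 2 * (p : ℝ) ^ 2 + 1)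
    (hlow : ∀ i ∈ lowIndices p, pairEigenvalue i.1 i.2 h ≤ lam) :
    spectralSum h lam = Submodule.span ℝ (range (lowMode p h)) := by
  have := finiteDimensional_spectralSum hh hlam
  symm
  apply Submodule.eq_of_le_of_finrank_le
  · rw [Submodule.span_le]
    rintro _ ⟨i, rfl⟩
    exact eigenspace_le_spectralSum h (hlow i.1 i.2) (modeQuad_mem_eigenspace _ _ hh)
  · rw [finrank_span_lowMode p hh]
    exact finrank_spectralSum_le hh hlam

theorem lt_diag_of_mem_lowIndices {p : ℕ} {h : ℝ} (hh : 0 ≤ h)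
    (hlt : ∀ i ∈ lowIndices p, i ≠ (p, p) → pairEigenvalue i.1 i.2 h < 2 * (p : ℝ) ^ 2)
    {i : ℕ × ℕ} (hi : i ∈ lowIndices p) (hne : i ≠ (p, p)) :
    pairEigenvalue i.1 i.2 h < pairEigenvalue p p h :=
  (hlt i hi hne).trans_le (by linarith [le_pairEigenvalue p p hh])

theorem le_diag_of_mem_lowIndices {p : ℕ} {h : ℝ} (hh : 0 ≤ h)
    (hlt : ∀ i ∈ lowIndices p, i ≠ (p, p) → pairEigenvalue i.1 i.2 h < 2 * (p : ℝ) ^ 2)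
    {i : ℕ × ℕ} (hi : i ∈ lowIndices p) :
    pairEigenvalue i.1 i.2 h ≤ pairEigenvalue p p h := by
  by_cases hne : i = (p, p)
  · rw [hne]
  · exact (lt_diag_of_mem_lowIndices hh hlt hi hne).le

theorem eigenspace_diag {p : ℕ} {h : ℝ} (hh : 0 ≤ h)
    (hdiag : pairEigenvalue p p h < 2 * (p : ℝ) ^ 2 + 1)
    (hlt : ∀ i ∈ lowIndices p, i ≠ (p, p) → pairEigenvalue i.1 i.2 h < 2 * (p : ℝ) ^ 2) :
    eigenspace h (pairEigenvalue p p h) = Submodule.span ℝ {(modeQuad p p h).1} := by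
  apply le_antisymm
  · intro u hu
    have hu' := eigenspace_le_spectralSum h le_rfl hu
    rw [spectralSum_eq_span hh hdiag fun i hi => le_diag_of_mem_lowIndices hh hlt hi,
      Submodule.mem_span_range_iff_exists_fun] at hu'
    obtain ⟨c, hc⟩ := hu'
    rw [Submodule.mem_span_singleton]
    refine ⟨c ⟨(p, p), diag_mem_lowIndices p⟩, ?_⟩
    rw [← hc]
    symm
    refine Finset.sum_eq_single_of_mem _ (Finset.mem_univ _) fun i _ hi => ?_
    have hi' : i.1 ≠ (p, p) := fun e => hi (Subtype.ext e)
    have h0 : inner ℝ (lowMode p h i) u = 0 :=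
      inner_eigenspace (lt_diag_of_mem_lowIndices hh hlt i.2 hi').ne
        (modeQuad_mem_eigenspace _ _ hh) hu
    rw [← hc, inner_sum, Finset.sum_eq_single_of_mem i (Finset.mem_univ _) (fun j _ hji => by
      rw [real_inner_smul_right]
      exact mul_eq_zero_of_right _ (inner_modeQuad_of_ne (fun e => hji (Subtype.ext e.symm)) hh)),
      real_inner_smul_right] at h0
    rw [(mul_eq_zero.1 h0).resolve_right (inner_modeQuad_self_pos _ _ hh).ne', zero_smul]
  · rw [Submodule.span_singleton_le_iff_mem]
    exact modeQuad_mem_eigenspace p p hh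

theorem nthEigenvalue_diag {p : ℕ} {h : ℝ} (hh : 0 ≤ h)
    (hdiag : pairEigenvalue p p h < 2 * (p : ℝ) ^ 2 + 1)
    (hlt : ∀ i ∈ lowIndices p, i ≠ (p, p) → pairEigenvalue i.1 i.2 h < 2 * (p : ℝ) ^ 2) :
    nthEigenvalue h (lowIndices p).card = pairEigenvalue p p h := by
  have hfd := finiteDimensional_spectralSum hh hdiag
  have hfr : Module.finrank ℝ (spectralSum h (pairEigenvalue p p h)) = (lowIndices p).card := by
    rw [spectralSum_eq_span hh hdiag fun i hi => le_diag_of_mem_lowIndices hh hlt hi,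
      finrank_span_lowMode p hh]
  refine IsLeast.csInf_eq ⟨?_, ?_⟩
  · rw [mem_ofPred_eq, ← hfr, Module.finrank_eq_rank]
  · intro lam hlam
    -- A smaller `lam` with enough dimension would have the same spectral sum, which would contain
    -- the `(p, p)` product although all its eigenspaces are orthogonal to it.
    by_contra hcon
    rw [not_le] at hcon
    have hle := spectralSum_mono h hcon.le
    have hfd' : FiniteDimensional ℝ (spectralSum h lam) := Submodule.finiteDimensional_of_le hle
    rw [mem_ofPred_eq, ← Module.finrank_eq_rank, Nat.cast_le] at hlam
    have heq := Submodule.eq_of_le_of_finrank_le hle (hfr.trans_le hlam)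
    have hmem : (modeQuad p p h).1 ∈ spectralSum h lam := by
      rw [heq]
      exact eigenspace_le_spectralSum h le_rfl (modeQuad_mem_eigenspace p p hh)
    have hort : spectralSum h lam ≤ (Submodule.span ℝ {(modeQuad p p h).1})ᗮ := by
      refine iSup₂_le fun mu hmu u hu => ?_
      rw [Submodule.mem_orthogonal_singleton_iff_inner_right]
      exact inner_eigenspace (hmu.trans_lt hcon).ne' (modeQuad_mem_eigenspace p p hh) hu
    have := Submodule.mem_orthogonal_singleton_iff_inner_right.1 (hort hmem)
    exact (inner_modeQuad_self_pos p p hh).ne' this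

/-- A second representation of `2p²` would give an orthogonal nonzero eigenfunction in a
one-dimensional space. -/
theorem diag_unique_of_finrank_eq_one {p : ℕ}
    (hp : Module.finrank ℝ (eigenspace 0 (pairEigenvalue p p 0)) = 1) {i : ℕ × ℕ}
    (hi : i.1 ^ 2 + i.2 ^ 2 = 2 * p ^ 2) : i = (p, p) := by
  by_contra hne
  have hval : pairEigenvalue i.1 i.2 0 = pairEigenvalue p p 0 := by
    rw [pairEigenvalue_zero, pairEigenvalue_zero, ← two_mul]
    exact_mod_cast hi
  have m1 : (modeQuad i.1 i.2 0).1 ∈ eigenspace 0 (pairEigenvalue p p 0) :=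
    hval ▸ modeQuad_mem_eigenspace i.1 i.2 le_rfl
  obtain ⟨c, hc⟩ := (finrank_eq_one_iff_of_nonzero'
    (⟨_, modeQuad_mem_eigenspace p p le_rfl⟩ : eigenspace 0 (pairEigenvalue p p 0))
    (fun e => modeQuad_fst_ne_zero p p le_rfl (congrArg Subtype.val e))).1 hp ⟨_, m1⟩
  have hc' : c • (modeQuad p p 0).1 = (modeQuad i.1 i.2 0).1 := congrArg Subtype.val hc
  have h0 := inner_modeQuad_self_pos i.1 i.2 le_rfl
  nth_rewrite 2 [← hc'] at h0
  rw [real_inner_smul_right, inner_modeQuad_of_ne hne le_rfl, mul_zero] at h0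
  exact h0.false

/-- Finitely many strict inequalities at `h = 0` persist by continuity. The fixed threshold `2p²`
suffices, since `le_pairEigenvalue` keeps the diagonal eigenvalue above it. -/
theorem exists_small_h {p : ℕ} (hs : ∀ i : ℕ × ℕ, i.1 ^ 2 + i.2 ^ 2 = 2 * p ^ 2 → i = (p, p)) :
    ∃ h₀ : ℝ, 0 < h₀ ∧ ∀ h : ℝ, 0 ≤ h → h ≤ h₀ →
      pairEigenvalue p p h < 2 * (p : ℝ) ^ 2 + 1 ∧
      ∀ i ∈ lowIndices p, i ≠ (p, p) → pairEigenvalue i.1 i.2 h < 2 * (p : ℝ) ^ 2 := by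
  have h1 : ∀ᶠ h in 𝓝[≥] (0 : ℝ), pairEigenvalue p p h < 2 * (p : ℝ) ^ 2 + 1 :=
    (tendsto_pairEigenvalue p p).eventually_lt_const (by linarith)
  have h2 : ∀ᶠ h in 𝓝[≥] (0 : ℝ), ∀ i ∈ lowIndices p, i ≠ (p, p) →
      pairEigenvalue i.1 i.2 h < 2 * (p : ℝ) ^ 2 := by
    rw [Filter.eventually_all_finset]
    intro i hi
    by_cases hne : i = (p, p)
    · exact Eventually.of_forall fun _ h' => absurd hne h'
    · have : i.1 ^ 2 + i.2 ^ 2 < 2 * p ^ 2 :=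
        lt_of_le_of_ne (mem_lowIndices.1 hi) fun e => hne (hs i e)
      refine ((tendsto_pairEigenvalue i.1 i.2).eventually_lt_const ?_).mono fun _ h' _ => h'
      exact_mod_cast this
  obtain ⟨h₀, hpos, hsub⟩ := mem_nhdsGE_iff_exists_Icc_subset.1 (h1.and h2)
  exact ⟨h₀, hpos, fun h ha hb => hsub ⟨ha, hb⟩⟩

/-! ### Nodal domains. -/

/-- The index map to discrete `ι` is continuous, hence factors through the components; preconnected
pieces make the factor injective. -/
theorem card_connectedComponents_of_partition {X ι : Type*} [TopologicalSpace X] (C : ι → Set X)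
    (hopen : ∀ i, IsOpen (C i)) (hconn : ∀ i, IsPreconnected (C i)) (hne : ∀ i, (C i).Nonempty)
    (hdisj : ∀ i j x, x ∈ C i → x ∈ C j → i = j) (hcover : ∀ x, ∃ i, x ∈ C i) :
    ENat.card (ConnectedComponents X) = ENat.card ι := by
  let _ : TopologicalSpace ι := ⊥
  have : DiscreteTopology ι := ⟨rfl⟩
  choose f hf using hcover
  have hpre : ∀ i, f ⁻¹' {i} = C i := fun i => Set.ext fun x =>
    ⟨fun h => (show f x = i from h) ▸ hf x, fun h => hdisj _ _ x (hf x) h⟩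
  have hcont : Continuous f := continuous_discrete_rng.2 fun i => hpre i ▸ hopen i
  refine ENat.card_congr (Equiv.ofBijective hcont.connectedComponentsLift ⟨?_, ?_⟩)
  · intro a b
    obtain ⟨x, rfl⟩ := ConnectedComponents.surjective_coe a
    obtain ⟨y, rfl⟩ := ConnectedComponents.surjective_coe b
    intro e
    rw [hcont.connectedComponentsLift_apply_coe, hcont.connectedComponentsLift_apply_coe] at e
    rw [ConnectedComponents.coe_eq_coe']
    exact (hconn (f y)).subset_connectedComponent (hf y) (e ▸ hf x)
  · intro i
    obtain ⟨x, hx⟩ := hne i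
    exact ⟨x, (hcont.connectedComponentsLift_apply_coe x).trans (hdisj _ _ x (hf x) hx)⟩

/-- The points of `(-π/2, π/2)` in the `k`-th nodal interval of `mode p h`. -/
def nodalInterval (p : ℕ) (h : ℝ) (k : ℕ) : Set ℝ :=
  {x | x ∈ Ioo (-(Real.pi / 2)) (Real.pi / 2) ∧
    robinAlpha p h / Real.pi * x + p * Real.pi / 2 ∈
      Ioo (k * Real.pi - Real.pi / 2) (k * Real.pi + Real.pi / 2)}

theorem isOpen_nodalInterval (p : ℕ) (h : ℝ) (k : ℕ) : IsOpen (nodalInterval p h k) :=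
  isOpen_Ioo.inter (isOpen_Ioo.preimage (by fun_prop))

theorem isPreconnected_nodalInterval (p : ℕ) {h : ℝ} (hh : 0 ≤ h) (k : ℕ) :
    IsPreconnected (nodalInterval p h k) := by
  have hα : 0 ≤ robinAlpha p h / Real.pi :=
    div_nonneg (le_trans (by positivity) (robinAlpha_spec p hh).1.1) Real.pi_pos.le
  have hmono : Monotone fun x : ℝ => robinAlpha p h / Real.pi * x + p * Real.pi / 2 :=
    fun x y hxy => by
      have := mul_le_mul_of_nonneg_left hxy hα
      dsimp only
      linarith
  exact (ordConnected_Ioo.inter (ordConnected_Ioo.preimage_mono hmono)).isPreconnected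

theorem nodalInterval_unique {p : ℕ} {h : ℝ} {j k : ℕ} {x : ℝ} (hj : x ∈ nodalInterval p h j)
    (hk : x ∈ nodalInterval p h k) : j = k := by
  have hπ := Real.pi_pos
  have i1 : (j : ℝ) < k + 1 :=
    lt_of_mul_lt_mul_right (by linarith [hj.2.1, hk.2.2]) hπ.le
  have i2 : (k : ℝ) < j + 1 :=
    lt_of_mul_lt_mul_right (by linarith [hk.2.1, hj.2.2]) hπ.le
  have i1' : j < k + 1 := by exact_mod_cast i1
  have i2' : k < j + 1 := by exact_mod_cast i2
  omega

theorem mode_ne_zero_of_mem {p : ℕ} {h : ℝ} {k : ℕ} {x : ℝ} (hx : x ∈ nodalInterval p h k) :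
    mode p h x ≠ 0 := by
  have e : robinAlpha p h / Real.pi * x + p * Real.pi / 2 =
    (robinAlpha p h / Real.pi * x + p * Real.pi / 2 - k * Real.pi) + k * Real.pi := by ring
  have hc := Real.cos_pos_of_mem_Ioo (x := robinAlpha p h / Real.pi * x + p * Real.pi / 2 -
    k * Real.pi) ⟨by linarith [hx.2.1], by linarith [hx.2.2]⟩
  have hs := Real.sin_sq_add_cos_sq (k * Real.pi)
  rw [Real.sin_nat_mul_pi] at hs
  rw [mode, e, Real.cos_add, Real.sin_nat_mul_pi, mul_zero, sub_zero]
  refine mul_ne_zero hc.ne' fun h0 => ?_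
  rw [h0] at hs
  norm_num at hs

/-- Since `α < (p + 1)π`, the phase stays strictly between `-π/2` and `pπ + π/2`, which leaves only
the indices `0, …, p`. -/
theorem exists_mem_nodalInterval {p : ℕ} {h : ℝ} (hh : 0 ≤ h) {x : ℝ}
    (hx : x ∈ Ioo (-(Real.pi / 2)) (Real.pi / 2)) (hne : mode p h x ≠ 0) :
    ∃ k < p + 1, x ∈ nodalInterval p h k := by
  have hπ := Real.pi_pos
  obtain ⟨h1, h2⟩ := (robinAlpha_spec p hh).1
  have hα : 0 ≤ robinAlpha p h := le_trans (by positivity) h1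
  set θ := robinAlpha p h / Real.pi * x + p * Real.pi / 2 with hθ
  have hb : |robinAlpha p h / Real.pi * x| ≤ robinAlpha p h / 2 := by
    rw [abs_mul, abs_of_nonneg (div_nonneg hα hπ.le), div_mul_eq_mul_div, div_le_iff₀ hπ]
    nlinarith [abs_le.2 ⟨hx.1.le, hx.2.le⟩]
  obtain ⟨b1, b2⟩ := abs_le.1 hb
  set t := (θ + Real.pi / 2) / Real.pi with ht
  have ht' : t * Real.pi = θ + Real.pi / 2 := by rw [ht]; field_simp
  have t0 : 0 ≤ t := div_nonneg (by linarith) hπ.le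
  have tp : t < (p + 1 : ℕ) := by
    rw [ht, div_lt_iff₀ hπ]; push_cast; linarith
  have f1 := Nat.floor_le t0
  have f2 := Nat.lt_floor_add_one t
  have f1' := mul_le_mul_of_nonneg_right f1 hπ.le
  have f2' := mul_lt_mul_of_pos_right f2 hπ
  refine ⟨⌊t⌋₊, (Nat.floor_lt t0).2 tp, hx, lt_of_le_of_ne (by linarith) fun e => hne ?_,
    by linarith⟩
  rw [mode, ← e, Real.cos_sub, Real.sin_nat_mul_pi, Real.cos_pi_div_two, mul_zero,
    zero_mul, add_zero]

theorem nodalInterval_nonempty {p : ℕ} {h : ℝ} (hh : 0 ≤ h) {k : ℕ} (hk : k < p + 1) :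
    (nodalInterval p h k).Nonempty := by
  have hπ := Real.pi_pos
  obtain ⟨h1, h2⟩ := (robinAlpha_spec p hh).1
  have hp : (0 : ℝ) < p + 1 := by positivity
  have hkp : (k : ℝ) ≤ p := by exact_mod_cast Nat.lt_succ_iff.1 hk
  have hk0 : (0 : ℝ) ≤ k := by positivity
  -- `qπ/2` is the midpoint of the `k`-th of `p + 1` equal parts of the side. The phase there is
  -- within `π/2` of `kπ` because `|q| < 1` and `0 < (p + 1)π - α ≤ π`.
  set q : ℝ := (2 * k - p) / (p + 1) with hq
  have hq1 : -1 < q := by rw [hq, lt_div_iff₀ hp]; linarith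
  have hq2 : q < 1 := by rw [hq, div_lt_iff₀ hp]; linarith
  have hqp : q * (p + 1) = 2 * k - p := by rw [hq]; field_simp
  have e : robinAlpha p h / Real.pi * (q * (Real.pi / 2)) + p * Real.pi / 2 =
      k * Real.pi - q * (((p + 1) * Real.pi - robinAlpha p h) / 2) := by
    field_simp
    linear_combination Real.pi * hqp
  have hd0 : 0 < (p + 1) * Real.pi - robinAlpha p h := by linarith
  have hd1 : (p + 1) * Real.pi - robinAlpha p h ≤ Real.pi := by linarith
  refine ⟨q * (Real.pi / 2), ⟨by nlinarith, by nlinarith⟩, ?_⟩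
  rw [e]
  exact ⟨by nlinarith, by nlinarith⟩

/-- The nodal domains are the products of two nodal intervals. -/
theorem card_nodalDomains_modeProd (p : ℕ) {h : ℝ} (hh : 0 ≤ h) {c : ℝ} (hc : c ≠ 0) :
    ENat.card (ConnectedComponents {z : ℝ × ℝ // z ∈ square ∧ c * modeProd p p h z ≠ 0}) =
      ((p + 1) ^ 2 : ℕ) := by
  have hmem : ∀ {j k : ℕ} {z : ℝ × ℝ}, z.1 ∈ nodalInterval p h j → z.2 ∈ nodalInterval p h k →
      z ∈ square ∧ c * modeProd p p h z ≠ 0 := fun h1 h2 =>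
    ⟨⟨h1.1, h2.1⟩, mul_ne_zero hc (mul_ne_zero (mode_ne_zero_of_mem h1) (mode_ne_zero_of_mem h2))⟩
  rw [card_connectedComponents_of_partition (ι := Fin (p + 1) × Fin (p + 1))
    fun i => {z | z.1.1 ∈ nodalInterval p h i.1 ∧ z.1.2 ∈ nodalInterval p h i.2}]
  · rw [ENat.card_eq_coe_fintype_card]
    simp [sq]
  · intro i
    exact ((isOpen_nodalInterval p h i.1).preimage (by fun_prop)).inter
      ((isOpen_nodalInterval p h i.2).preimage (by fun_prop))
  · intro i
    have hind : IsInducing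
        (Subtype.val : {z : ℝ × ℝ // z ∈ square ∧ c * modeProd p p h z ≠ 0} → ℝ × ℝ) := ⟨rfl⟩
    rw [← hind.isPreconnected_image]
    convert (isPreconnected_nodalInterval p hh i.1).prod (isPreconnected_nodalInterval p hh i.2)
    ext z
    constructor
    · rintro ⟨w, hw, rfl⟩; exact hw
    · rintro ⟨h1, h2⟩; exact ⟨⟨z, hmem h1 h2⟩, ⟨h1, h2⟩, rfl⟩
  · intro i
    obtain ⟨x, hx⟩ := nodalInterval_nonempty hh i.1.2
    obtain ⟨y, hy⟩ := nodalInterval_nonempty hh i.2.2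
    exact ⟨⟨(x, y), hmem hx hy⟩, hx, hy⟩
  · intro i j z hi hj
    exact Prod.ext (Fin.ext (nodalInterval_unique hi.1 hj.1))
      (Fin.ext (nodalInterval_unique hi.2 hj.2))
  · intro z
    have hz := (mul_ne_zero_iff.1 z.2.2).2
    obtain ⟨j, hj, hj'⟩ := exists_mem_nodalInterval hh z.2.1.1 (mul_ne_zero_iff.1 hz).1
    obtain ⟨k, hk, hk'⟩ := exists_mem_nodalInterval hh z.2.1.2 (mul_ne_zero_iff.1 hz).2
    exact ⟨(⟨j, hj⟩, ⟨k, hk⟩), hj', hk'⟩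

theorem HasNodalDomains.unique {u : L2S} {m n : ℕ} (hm : HasNodalDomains u m)
    (hn : HasNodalDomains u n) : m = n := by
  obtain ⟨f, hf, huf, hcf⟩ := hm
  obtain ⟨g, hg, hug, hcg⟩ := hn
  have heq : EqOn f g square := Measure.eqOn_open_of_ae_eq (huf.symm.trans hug)
    (isOpen_Ioo.prod isOpen_Ioo) hf hg
  have hset : (fun z => z ∈ square ∧ f z ≠ 0) = fun z => z ∈ square ∧ g z ≠ 0 := by
    funext z
    exact propext (and_congr_right fun hz => by rw [heq hz])
  rw [hset, hcg] at hcf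
  exact_mod_cast hcf.symm

theorem hasNodalDomains_of_mem_span (p : ℕ) {h : ℝ} (hh : 0 ≤ h) {u : L2S}
    (hu : u ∈ Submodule.span ℝ {(modeQuad p p h).1}) (hne : u ≠ 0) :
    HasNodalDomains u ((p + 1) ^ 2) := by
  obtain ⟨c, rfl⟩ := Submodule.mem_span_singleton.1 hu
  have hc : c ≠ 0 := fun e => hne (by rw [e, zero_smul])
  refine ⟨fun z => c * modeProd p p h z, by fun_prop, ?_, card_nodalDomains_modeProd p hh hc⟩
  filter_upwards [Lp.coeFn_smul c (modeQuad p p h).1, modeQuad_fst_ae p p h] with z h1 h2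
  rw [h1, Pi.smul_apply, h2, smul_eq_mul]

theorem exists_not_courantSharp {p n : ℕ} (hn : (lowIndices p).card = n) (hne : n ≠ (p + 1) ^ 2)
    (hs : ∀ i ∈ lowIndices p, i.1 ^ 2 + i.2 ^ 2 = 2 * p ^ 2 → i = (p, p)) :
    ∃ h₀ : ℝ, 0 < h₀ ∧ ∀ h : ℝ, 0 < h → h ≤ h₀ → ¬ CourantSharp h n := by
  obtain ⟨h₀, hpos, H⟩ := exists_small_h fun i hi => hs i (mem_lowIndices.2 hi.le) hi
  refine ⟨h₀, hpos, fun h h0 hle => ?_⟩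
  obtain ⟨H1, H2⟩ := H h h0.le hle
  rintro ⟨u, hu, hu0, hnd⟩
  rw [← hn, nthEigenvalue_diag h0.le H1 H2, eigenspace_diag h0.le H1 H2] at hu
  exact hne (hnd.unique (hasNodalDomains_of_mem_span p h0.le hu hu0))

end RobinSquare

theorem mainTheorem11 :
    (∀ p : ℕ,
      Module.finrank ℝ (RobinSquare.eigenspace 0 (RobinSquare.pairEigenvalue p p 0)) = 1 →
      ∃ h₀ : ℝ, 0 < h₀ ∧ ∀ h : ℝ, 0 ≤ h → h ≤ h₀ →
        Module.finrank ℝ (RobinSquare.eigenspace h (RobinSquare.pairEigenvalue p p h)) = 1 ∧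
        ∀ Ψ ∈ RobinSquare.eigenspace h (RobinSquare.pairEigenvalue p p h), Ψ ≠ 0 →
          RobinSquare.HasNodalDomains Ψ ((p + 1) ^ 2)) ∧
    (∃ h₀ : ℝ, 0 < h₀ ∧ ∀ h : ℝ, 0 < h → h ≤ h₀ →
      ∀ n ∈ ({20, 31, 65, 86, 113} : Set ℕ), ¬ RobinSquare.CourantSharp h n) := by
  constructor
  · intro p hp
    obtain ⟨h₀, hpos, H⟩ := RobinSquare.exists_small_h fun i hi =>
      RobinSquare.diag_unique_of_finrank_eq_one hp hi
    refine ⟨h₀, hpos, fun h h0 hle => ?_⟩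
    obtain ⟨H1, H2⟩ := H h h0 hle
    rw [RobinSquare.eigenspace_diag h0 H1 H2]
    exact ⟨finrank_span_singleton (RobinSquare.modeQuad_fst_ne_zero p p h0),
      fun Ψ hΨ hne => RobinSquare.hasNodalDomains_of_mem_span p h0 hΨ hne⟩
  -- The indices 20, 31, 65, 86, 113 face 16, 25, 49, 64, 81 nodal domains. The value `p = 5` is
  -- absent, as `50 = 1 + 49` is not simple.
  · obtain ⟨a, ha, Ha⟩ := RobinSquare.exists_not_courantSharp (p := 3) (n := 20)
      (by decide +kernel) (by decide) (by decide +kernel)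
    obtain ⟨b, hb, Hb⟩ := RobinSquare.exists_not_courantSharp (p := 4) (n := 31)
      (by decide +kernel) (by decide) (by decide +kernel)
    obtain ⟨c, hc, Hc⟩ := RobinSquare.exists_not_courantSharp (p := 6) (n := 65)
      (by decide +kernel) (by decide) (by decide +kernel)
    obtain ⟨d, hd, Hd⟩ := RobinSquare.exists_not_courantSharp (p := 7) (n := 86)
      (by decide +kernel) (by decide) (by decide +kernel)
    obtain ⟨e, he, He⟩ := RobinSquare.exists_not_courantSharp (p := 8) (n := 113)
      (by decide +kernel) (by decide) (by decide +kernel)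
    refine ⟨min a (min b (min c (min d e))), by positivity, fun h h0 hle => ?_⟩
    simp only [le_min_iff] at hle
    obtain ⟨la, lb, lc, ld, le⟩ := hle
    rintro n (rfl | rfl | rfl | rfl | rfl)
    exacts [Ha h h0 la, Hb h h0 lb, Hc h h0 lc, Hd h h0 ld, He h h0 le]
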